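/- Let $T>0$, $\alpha>\frac12$, and let $|\cdot|$ denote Euclidean norms. Let $f:[0,T]\times\mathbb R^n\to\mathbb R^n$ be measurable in $t$ and let $\sigma:[0,T]\times\mathbb R^n\to\mathbb R^{n\times m}$ be differentiable in $x$. Assume: (i) there is $M>0$ with $|\sigma(t,x)-\sigma(t,y)|\le M|x-y|$ and $|\sigma(t,x)-\sigma(s,x)|+|\partial_{x_i}\sigma(t,x)-\partial_{x_i}\sigma(s,x)|\le M|t-s|$ for all $x,y\in\mathbb R^n$, $s,t\in[0,T]$ and all $i$; (ii) for every $N>0$ there is $M_N>0$ with $|\partial_{x_i}\sigma(t,x)-\partial_{x_i}\sigma(t,y)|\le M_N|x-y|$ for all $|x|,|y|\le N$, $t\in[0,T]$ and all $i$; (iii) there are $K_0>0$ and $\zeta\in[0,1]$ with $|\sigma(t,x)|\le K_0(1+|x|^\zeta)$ for all $x\in\mathbb R^n$, $t\in[0,T]$; (iv) for every $N>0$ there is $L_N>0$ with $|f(t,x)-f(t,y)|\le L_N|x-y|$ for all $|x|,|y|\le N$, $t\in[0,T]$; (v) there are $L_0>0$ and a real-valued $b_0\in L^\rho(0,T)$,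 where $2<\rho\le\infty$, with $|f(t,x)|\le L_0|x|+b_0(t)$ for all $x\in\mathbb R^n$, $t\in[0,T]$. Fix $\beta>0$ with $\beta\in(1-\alpha,\frac12)$ and $\rho\ge\frac1\beta$. Put $$\|g\|_{1,1-\beta}=\sup_{0<s<t<T}\left[\frac{|g(t)-g(s)|}{(t-s)^{1-\beta}}+\int_s^t\frac{|g(y)-g(s)|}{|y-s|^{2-\beta}}\,dy\right],\qquad \|v\|_{\beta,\infty}=\sup_{t\in[0,T]}\left[|v(t)|+\int_0^t\frac{|v(t)-v(s)|}{|t-s|^{\beta+1}}\,ds\right],$$ and let $C_\gamma$ be the space of $\gamma$-Hölder continuous functions on $[0,T]$. For scalar functions and $a<b$, the generalised Lebesgue–Stieltjes integral is $$\int_a^b h\,dg=(-1)^\beta\int_a^b D^\beta_{a+}(h-h(a+))(t)\,D^{1-\beta}_{b-}(g-g(b-))(t)\,dt+h(a+)\,(g(b-)-g(a+)),$$ with the Weyl–Marchaud derivatives, for $0<\gamma<1$, $$D^\gamma_{a+}h(t)=\frac1{\Gamma(1-\gamma)}\left(\frac{h(t)}{(t-a)^\gamma}+\gamma\int_a^t\frac{h(t)-h(s)}{(t-s)^{\gamma+1}}\,ds\right),\qquad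 D^\gamma_{b-}g(t)=\frac{(-1)^\gamma}{\Gamma(1-\gamma)}\left(\frac{g(t)}{(b-t)^\gamma}+\gamma\int_t^b\frac{g(t)-g(s)}{(s-t)^{\gamma+1}}\,ds\right),$$ where $(-1)^\gamma=e^{i\pi\gamma}$ (so the prefactors multiply to $-1$); $\int_a^a h\,dg=0$, and $\int A\,dg$ for matrix-valued $A$ and vector-valued $g$ has the coordinates $\sum_j\int A_{ij}\,dg_j$. Let $x\in\mathbb R^n$, let $\omega\in C_\alpha$ be $\mathbb R^m$-valued, let $(G_\delta)_{\delta\in\mathcal D}$ be any family of $\mathbb R^m$-valued functions in $C_\alpha$, and let $u$ and $u_\delta$ ($\delta\in\mathcal D$) in $C_{1-\beta}$ be solutions on $[0,T]$ of $$u(t)-x=\int_0^t f(s,u(s))\,ds+\int_0^t\sigma(s,u(s))\,d\omega(s),\qquad u_\delta(t)-x=\int_0^t f(s,u_\delta(s))\,ds+\int_0^t\sigma(s,u_\delta(s))\,dG_\delta(s).$$ If $\sup_{\delta\in\mathcal D}\|G_\delta\|_{1,1-\beta}<\infty$, then there is a constant $K$, independent of $\delta\in\mathcal D$, such that $$\|u_\delta-u\|_{\beta,\infty}\le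 K\,\|G_\delta-\omega\|_{1,1-\beta}\qquad\text{for all }\delta\in\mathcal D .$$ In particular, if $\|G_\delta-\omega\|_{1,1-\beta}\to0$ along some filter on $\mathcal D$ (for instance, along a sequence), then $\|u_\delta-u\|_{\beta,\infty}\to0$ along it. -/

import Mathlib

open Set Filter Topology MeasureTheory
open scoped NNReal ENNReal

noncomputable section

namespace FracSDE

/-- Left Weyl--Marchaud derivative `D^γ_{a+} f (t)` of order `γ ∈ (0,1)`. -/
def leftDeriv (γ a : ℝ) (f : ℝ → ℝ) (t : ℝ) : ℝ :=
  1 / Real.Gamma (1 - γ) *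
    (f t / (t - a) ^ γ + γ * ∫ s in a..t, (f t - f s) / (t - s) ^ (γ + 1))

/-- Right Weyl--Marchaud derivative `D^γ_{b-} g (t)` of order `γ ∈ (0,1)`, without its
complex prefactor `(-1)^γ`; see `glsIntegral`. -/
def rightDeriv (γ b : ℝ) (g : ℝ → ℝ) (t : ℝ) : ℝ :=
  1 / Real.Gamma (1 - γ) *
    (g t / (b - t) ^ γ + γ * ∫ s in t..b, (g t - g s) / (s - t) ^ (γ + 1))

/-- The generalised Lebesgue--Stieltjes integral `∫_a^b f dg`, computed with order `γ`:
`(-1)^γ ∫_a^b D^γ_{a+} (f - f(a+)) (t) D^{1-γ}_{b-} (g - g(b-)) (t) dt + f(a+) (g(b-) - g(a+))`.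
The two prefactors `(-1)^γ` and `(-1)^(1-γ)` multiply to the sign `-1` below.
The integral over a degenerate interval is `0`. -/
def glsIntegral (γ : ℝ) (f g : ℝ → ℝ) (a b : ℝ) : ℝ :=
  if a < b then
    -(∫ t in a..b,
        leftDeriv γ a (fun s => f s - Function.rightLim f a) t *
          rightDeriv (1 - γ) b (fun s => g s - Function.leftLim g b) t)
      + Function.rightLim f a * (Function.leftLim g b - Function.rightLim g a)
  else 0

/-- `∫_a^b A dg ∈ ℝⁿ` for a function `A` with values in the real `n × m` matrices (with their
Euclidean norm) and `g` with values in `ℝᵐ`: the `i`-th coordinate is `∑_j ∫_a^b A_{ij} dg_j`. -/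
def glsIntegralVec {n m : ℕ} (γ : ℝ) (A : ℝ → EuclideanSpace ℝ (Fin n × Fin m))
    (g : ℝ → EuclideanSpace ℝ (Fin m)) (a b : ℝ) : EuclideanSpace ℝ (Fin n) :=
  WithLp.toLp 2 fun i => ∑ j, glsIntegral γ (fun s => A s (i, j)) (fun s => g s j) a b

/-- `‖g‖_{1,1-β}` on `(0,T)`, as an extended nonnegative number. -/
def driverNorm {m : ℕ} (β T : ℝ) (g : ℝ → EuclideanSpace ℝ (Fin m)) : ℝ≥0∞ :=
  ⨆ (s : ℝ) (t : ℝ) (_ : 0 < s) (_ : s < t) (_ : t < T),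
    (ENNReal.ofReal (‖g t - g s‖ / (t - s) ^ (1 - β))
      + ∫⁻ y in Ioo s t, ENNReal.ofReal (‖g y - g s‖ / |y - s| ^ (2 - β)))

/-- `‖v‖_{β,∞}` on `[0,T]`, as an extended nonnegative number. -/
def solutionNorm {n : ℕ} (β T : ℝ) (v : ℝ → EuclideanSpace ℝ (Fin n)) : ℝ≥0∞ :=
  ⨆ t ∈ Icc (0 : ℝ) T,
    (ENNReal.ofReal ‖v t‖
      + ∫⁻ s in Ioo 0 t, ENNReal.ofReal (‖v t - v s‖ / |t - s| ^ (β + 1)))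

/-- `v ∈ C_γ`: Hölder continuity of exponent `γ` on `[0,T]`. -/
def IsHolder {d : ℕ} (γ T : ℝ) (v : ℝ → EuclideanSpace ℝ (Fin d)) : Prop :=
  ∃ C : ℝ≥0, HolderOnWith C γ.toNNReal v (Icc 0 T)

/-- The partial derivative `∂_{x_i} σ (t, x)`. -/
def spaceDeriv {n m : ℕ}
    (σ : ℝ → EuclideanSpace ℝ (Fin n) → EuclideanSpace ℝ (Fin n × Fin m))
    (i : Fin n) (t : ℝ) (x : EuclideanSpace ℝ (Fin n)) : EuclideanSpace ℝ (Fin n × Fin m) :=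
  fderiv ℝ (σ t) x (EuclideanSpace.single i 1)

/-- Conditions (i)--(v) on the drift `f` and the diffusion coefficient `σ`. -/
structure CoefficientConditions {n m : ℕ} (T : ℝ) (ρ : ℝ≥0∞)
    (f : ℝ → EuclideanSpace ℝ (Fin n) → EuclideanSpace ℝ (Fin n))
    (σ : ℝ → EuclideanSpace ℝ (Fin n) → EuclideanSpace ℝ (Fin n × Fin m)) : Prop where
  /-- the drift is measurable in time -/
  measurable_f : ∀ x, AEStronglyMeasurable (fun t => f t x) (volume.restrict (Icc 0 T))
  /-- the diffusion coefficient is differentiable in space -/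
  differentiable_σ : ∀ t ∈ Icc 0 T, Differentiable ℝ (σ t)
  /-- (i) -/
  lipschitz_σ : ∃ M > (0 : ℝ),
    (∀ t ∈ Icc 0 T, ∀ x y, ‖σ t x - σ t y‖ ≤ M * ‖x - y‖) ∧
    ∀ t ∈ Icc 0 T, ∀ s ∈ Icc 0 T, ∀ x, ∀ i,
      ‖σ t x - σ s x‖ + ‖spaceDeriv σ i t x - spaceDeriv σ i s x‖ ≤ M * |t - s|
  /-- (ii) -/
  lipschitz_deriv : ∀ N > (0 : ℝ), ∃ MN > (0 : ℝ), ∀ t ∈ Icc 0 T, ∀ x y, ‖x‖ ≤ N → ‖y‖ ≤ N →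
    ∀ i, ‖spaceDeriv σ i t x - spaceDeriv σ i t y‖ ≤ MN * ‖x - y‖
  /-- (iii) -/
  growth_σ : ∃ K₀ > (0 : ℝ), ∃ ζ ∈ Icc (0 : ℝ) 1, ∀ t ∈ Icc 0 T, ∀ x,
    ‖σ t x‖ ≤ K₀ * (1 + ‖x‖ ^ ζ)
  /-- (iv) -/
  lipschitz_f : ∀ N > (0 : ℝ), ∃ LN > (0 : ℝ), ∀ t ∈ Icc 0 T, ∀ x y, ‖x‖ ≤ N → ‖y‖ ≤ N →
    ‖f t x - f t y‖ ≤ LN * ‖x - y‖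
  /-- (v) -/
  growth_f : 2 < ρ ∧ ∃ L₀ > (0 : ℝ), ∃ b₀ : ℝ → ℝ, MemLp b₀ ρ (volume.restrict (Icc 0 T)) ∧
    ∀ t ∈ Icc 0 T, ∀ x, ‖f t x‖ ≤ L₀ * ‖x‖ + b₀ t

/-- `u ∈ C_{1-β}` solves `u(t) - x = ∫_0^t f(s,u(s)) ds + ∫_0^t σ(s,u(s)) dg(s)` on `[0,T]`.
The second integral is the generalised Lebesgue--Stieltjes integral; order `β` is admissible as
`σ(·,u)` is Hölder continuous of exponent `1 - β > β` and `g` of some exponent above `1 - β`. -/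
def IsSolution {n m : ℕ} (β T : ℝ)
    (f : ℝ → EuclideanSpace ℝ (Fin n) → EuclideanSpace ℝ (Fin n))
    (σ : ℝ → EuclideanSpace ℝ (Fin n) → EuclideanSpace ℝ (Fin n × Fin m))
    (x : EuclideanSpace ℝ (Fin n)) (g : ℝ → EuclideanSpace ℝ (Fin m))
    (u : ℝ → EuclideanSpace ℝ (Fin n)) : Prop :=
  IsHolder (1 - β) T u ∧
    ∀ t ∈ Icc 0 T,
      u t - x = (∫ s in (0 : ℝ)..t, f s (u s)) + glsIntegralVec β (fun s => σ s (u s)) g 0 t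

end FracSDE

end

namespace FracSDE

/-! Everything rests on one Young-type estimate. On `[a, b]`, for an integrand with Hölder constant
`H` of exponent `1 - β` and a driver with norm bound `L`, the integral is at most `L (b - a)^(1-β)
(|f a| + Y H (b - a)^(1-β))` (`abs_glsIntegral_le`). The second factor `(b - a)^(1-β)` makes the
influence of `H` small on short intervals.

An equation whose increments obey such a bound (`StepBound`) satisfies a Gronwall lemma in Hölder
norm (`exists_holder_gronwall`): on intervals of a fixed length `h` the Hölder constant is absorbed,
and about `T / h` such intervals are chained. It is used twice. For a solution, with inhomogeneity
`1`, it gives a Hölder bound depending on the driver only through `L` (`exists_solution_bound`). For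
`v - u`, with inhomogeneity `ε` the norm of the difference of the drivers and initial value `0`, it
gives a Hölder norm of order `ε`, which controls the norm of the conclusion because `β < 1 - β`.

The inequality for `v - u` comes from `∫ σ(v) dg - ∫ σ(u) dω = ∫ (σ(v) - σ(u)) dg + ∫ σ(u) d(g -
ω)`. The Hölder constant of `σ(v) - σ(u)` is linear in `v - u` by a four-point estimate
(`norm_four_point_le`), which needs the local Lipschitz bound on the derivative of `σ` and hence the
uniform bound on solutions.

Localising the equation to `[a, b]` needs additivity of the integral over intervals, which is hidden
because the fractional derivatives depend on the endpoints. For `C¹` functions the integral is `∫ f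
g'`; the general case follows by approximation with Steklov averages. The exponent `α > 1 - β` of
the drivers serves additivity, linearity and finiteness of norms; the `α`-Hölder constants of the
family never enter the final constant. -/

/-- Hölder continuity on `s` with explicit real constant and exponent. -/
def HolOn {E : Type*} [NormedAddCommGroup E] (C r : ℝ) (s : Set ℝ) (f : ℝ → E) : Prop :=
  ∀ x ∈ s, ∀ y ∈ s, ‖f x - f y‖ ≤ C * |x - y| ^ r

/-! ### Hölder functions with explicit constants. -/

section HolOn

variable {E : Type*} [NormedAddCommGroup E] {C D r : ℝ} {s : Set ℝ} {f g : ℝ → E}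

lemma HolOn.mono {s' : Set ℝ} (h : HolOn C r s f) (hs : s' ⊆ s) : HolOn C r s' f :=
  fun x hx y hy => h x (hs hx) y (hs hy)

lemma HolOn.mono_const (h : HolOn C r s f) (hCD : C ≤ D) : HolOn D r s f :=
  fun x hx y hy => (h x hx y hy).trans (by gcongr)

lemma HolOn.continuousOn (h : HolOn C r s f) (hr : 0 < r) : ContinuousOn f s := by
  intro x hx
  rw [ContinuousWithinAt, tendsto_iff_norm_sub_tendsto_zero]
  have h0 : Tendsto (fun y => C * |y - x| ^ r) (𝓝[s] x) (𝓝 0) := by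
    have : Continuous fun y : ℝ => C * |y - x| ^ r :=
      continuous_const.mul ((continuous_id.sub continuous_const).abs.rpow_const
        fun _ => Or.inr hr.le)
    have h2 := (this.tendsto x).mono_left (nhdsWithin_le_nhds (s := s))
    simpa [Real.zero_rpow hr.ne'] using h2
  exact squeeze_zero' (Eventually.of_forall fun _ => norm_nonneg _)
    (eventually_mem_nhdsWithin.mono fun y hy => h y hy x hx) h0

lemma HolOn.continuous (h : HolOn C r univ f) (hr : 0 < r) : Continuous f :=
  continuousOn_univ.1 (h.continuousOn hr)

lemma HolOn.sub (hf : HolOn C r s f) (hg : HolOn D r s g) : HolOn (C + D) r s (f - g) := by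
  intro x hx y hy
  calc ‖(f - g) x - (f - g) y‖ = ‖(f x - f y) - (g x - g y)‖ := by
        simp only [Pi.sub_apply]; congr 1; abel
    _ ≤ ‖f x - f y‖ + ‖g x - g y‖ := norm_sub_le _ _
    _ ≤ _ := by rw [add_mul]; exact add_le_add (hf x hx y hy) (hg x hx y hy)

end HolOn

/-! ### The power kernel. -/

section Kernel

lemma intervalIntegrable_kernel {a t r : ℝ} (hr : -1 < r) :
    IntervalIntegrable (fun s => (t - s) ^ r) volume a t := by
  have h := (intervalIntegral.intervalIntegrable_rpow' (a := t - a) (b := 0) hr).comp_sub_left t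
  simpa using h

lemma integral_kernel {a t r : ℝ} (hr : -1 < r) :
    ∫ s in a..t, (t - s) ^ r = (t - a) ^ (r + 1) / (r + 1) := by
  rw [intervalIntegral.integral_comp_sub_left (fun s => s ^ r) t, integral_rpow (Or.inl hr)]
  rw [sub_self, Real.zero_rpow (by linarith), sub_zero]

end Kernel

/-! ### The left fractional derivative: bounds, measurability, limits. -/

section LeftDeriv

variable {γ a b C r : ℝ} {f : ℝ → ℝ}

lemma leftDeriv_sub_const (γ a c : ℝ) (f : ℝ → ℝ) (t : ℝ) :
    leftDeriv γ a (fun s => f s - c) t = 1 / Real.Gamma (1 - γ) *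
      ((f t - c) / (t - a) ^ γ + γ * ∫ s in a..t, (f t - f s) / (t - s) ^ (γ + 1)) := by
  simp [leftDeriv]

/-- The reflection `s ↦ -s` swaps the two derivatives, so facts about the right one are transported
from the left one. -/
lemma rightDeriv_eq_leftDeriv (γ b : ℝ) (g : ℝ → ℝ) (t : ℝ) :
    rightDeriv γ b g t = leftDeriv γ (-b) (fun s => g (-s)) (-t) := by
  have h := intervalIntegral.integral_comp_neg (a := -b) (b := -t)
    (fun s => (g t - g s) / (s - t) ^ (γ + 1))
  simp only [neg_neg] at h
  simp only [leftDeriv, rightDeriv, neg_neg]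
  rw [← h]
  congr 4
  · ring
  · ext s; congr 2; ring

lemma norm_quotient_le {t s : ℝ} (hst : s < t) (h : |f t - f s| ≤ C * |t - s| ^ r) :
    ‖(f t - f s) / (t - s) ^ (γ + 1)‖ ≤ C * (t - s) ^ (r - γ - 1) := by
  have hts : 0 < t - s := sub_pos.2 hst
  rw [norm_div, Real.norm_eq_abs, Real.norm_of_nonneg (Real.rpow_nonneg hts.le _),
    div_le_iff₀ (Real.rpow_pos_of_pos hts _), mul_assoc, ← Real.rpow_add hts]
  rw [abs_of_pos hts] at h
  rwa [show r - γ - 1 + (γ + 1) = r by ring]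

lemma intervalIntegrable_quotient (hγr : γ < r) (hf : HolOn C r (Icc a b) f)
    (hfm : Measurable f) {t : ℝ} (ht : t ∈ Icc a b) :
    IntervalIntegrable (fun s => (f t - f s) / (t - s) ^ (γ + 1)) volume a t := by
  have hk := (intervalIntegrable_kernel (a := a) (t := t) (r := r - γ - 1)
    (by linarith)).const_mul C
  refine hk.mono_fun ?_ ?_
  · exact Measurable.aestronglyMeasurable (by fun_prop)
  · have hne : ∀ᵐ s ∂(volume.restrict (uIoc a t)), s ≠ t :=
      ae_restrict_of_ae (by simp [ae_iff])
    filter_upwards [hne, ae_restrict_mem measurableSet_uIoc] with s hs hs'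
    rw [uIoc_of_le ht.1] at hs'
    have hst := lt_of_le_of_ne hs'.2 hs
    exact (norm_quotient_le hst (hf t ht s ⟨hs'.1.le, hs'.2.trans ht.2⟩)).trans (le_abs_self _)

lemma abs_integral_quotient_le (hγr : γ < r) (hf : HolOn C r (Icc a b) f) {t : ℝ}
    (ht : t ∈ Icc a b) :
    |∫ s in a..t, (f t - f s) / (t - s) ^ (γ + 1)| ≤ C * ((t - a) ^ (r - γ) / (r - γ)) := by
  have hk := intervalIntegrable_kernel (a := a) (t := t) (r := r - γ - 1) (by linarith)
  have h := intervalIntegral.norm_integral_le_of_norm_le (μ := volume) (a := a) (b := t)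
    (f := fun s => (f t - f s) / (t - s) ^ (γ + 1)) (g := fun s => C * (t - s) ^ (r - γ - 1))
    ht.1 ?_ (hk.const_mul C)
  · rw [intervalIntegral.integral_const_mul, integral_kernel (by linarith)] at h
    simpa using h
  · have hne : ∀ᵐ s : ℝ, s ≠ t := by simp [ae_iff]
    filter_upwards [hne] with s hs hs'
    exact norm_quotient_le (lt_of_le_of_ne hs'.2 hs) (hf t ht s ⟨hs'.1.le, hs'.2.trans ht.2⟩)

/-- The constant in the pointwise bound of the Weyl--Marchaud derivative. -/
noncomputable def derivConst (γ r : ℝ) : ℝ := 1 / Real.Gamma (1 - γ) * (1 + γ / (r - γ))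

lemma derivConst_nonneg (h0 : 0 < γ) (h1 : γ < 1) (hγr : γ < r) : 0 ≤ derivConst γ r := by
  have := Real.Gamma_pos_of_pos (sub_pos.2 h1)
  have := sub_pos.2 hγr
  unfold derivConst
  positivity

/-- The boundary term and the integral both have size `(t - a)^(r-γ)`; the integral converges
because the kernel exponent `r - γ - 1` exceeds `-1`. -/
lemma abs_leftDeriv_le (h0 : 0 < γ) (h1 : γ < 1) (hγr : γ < r) (hf : HolOn C r (Icc a b) f)
    {t : ℝ} (hat : a < t) (htb : t ≤ b) :
    |leftDeriv γ a (fun s => f s - f a) t| ≤ derivConst γ r * C * (t - a) ^ (r - γ) := by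
  have hΓ := Real.Gamma_pos_of_pos (sub_pos.2 h1)
  have hta : 0 < t - a := sub_pos.2 hat
  have hrγ := sub_pos.2 hγr
  rw [leftDeriv_sub_const, abs_mul, abs_of_pos (one_div_pos.2 hΓ), derivConst, mul_assoc,
    mul_assoc]
  refine mul_le_mul_of_nonneg_left ?_ (one_div_pos.2 hΓ).le
  have hA : |(f t - f a) / (t - a) ^ γ| ≤ C * (t - a) ^ (r - γ) := by
    have := hf t ⟨hat.le, htb⟩ a ⟨le_rfl, hat.le.trans htb⟩
    rw [abs_div, abs_of_pos (Real.rpow_pos_of_pos hta γ),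
      div_le_iff₀ (Real.rpow_pos_of_pos hta _), mul_assoc, ← Real.rpow_add hta, sub_add_cancel]
    simpa [abs_of_pos hta] using this
  have hB := abs_integral_quotient_le hγr hf ⟨hat.le, htb⟩
  calc _ ≤ |(f t - f a) / (t - a) ^ γ| + |γ * ∫ s in a..t, (f t - f s) / (t - s) ^ (γ + 1)| :=
        abs_add_le _ _
    _ ≤ C * (t - a) ^ (r - γ) + γ * (C * ((t - a) ^ (r - γ) / (r - γ))) := by
        rw [abs_mul, abs_of_pos h0]; gcongr
    _ = _ := by field_simp

/-- With the moving endpoint written into the integrand, joint measurability on the product gives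
measurability in the parameter. -/
lemma measurable_integral_quotient (γ a : ℝ) (hfm : Measurable f) :
    Measurable (fun t => ∫ s, if a < s ∧ s ≤ t then (f t - f s) / (t - s) ^ (γ + 1) else 0) := by
  have h : Measurable (fun p : ℝ × ℝ =>
      if a < p.2 ∧ p.2 ≤ p.1 then (f p.1 - f p.2) / (p.1 - p.2) ^ (γ + 1) else 0) := by
    refine Measurable.ite ?_ (by fun_prop) measurable_const
    exact (measurableSet_lt measurable_const measurable_snd).inter
      (measurableSet_le measurable_snd measurable_fst)
  exact h.stronglyMeasurable.integral_prod_right'.measurable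

lemma integral_quotient_eq {t : ℝ} (hat : a ≤ t) (F : ℝ → ℝ → ℝ) :
    ∫ s in a..t, F t s = ∫ s, if a < s ∧ s ≤ t then F t s else 0 := by
  rw [intervalIntegral.integral_of_le hat, ← integral_indicator measurableSet_Ioc]
  simp only [indicator, mem_Ioc]

lemma aestronglyMeasurable_leftDeriv (γ a b : ℝ) (hfm : Measurable f) :
    AEStronglyMeasurable (fun t => leftDeriv γ a (fun s => f s - f a) t)
      (volume.restrict (Ioc a b)) := by
  have h := measurable_integral_quotient γ a hfm
  have h2 : Measurable fun t => 1 / Real.Gamma (1 - γ) * ((f t - f a) / (t - a) ^ γ + γ *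
      ∫ s, if a < s ∧ s ≤ t then (f t - f s) / (t - s) ^ (γ + 1) else 0) := by fun_prop
  refine h2.aestronglyMeasurable.congr ?_
  filter_upwards [ae_restrict_mem measurableSet_Ioc] with t ht
  rw [leftDeriv_sub_const, integral_quotient_eq ht.1.le fun t s => (f t - f s) / (t - s) ^ (γ + 1)]

/-- Dominated convergence: the common Hölder constant `C` supplies the integrable majorant `C (t -
s)^(r-γ-1)`. -/
lemma tendsto_leftDeriv {F : ℕ → ℝ → ℝ} (hγr : γ < r) (hF : ∀ k, HolOn C r (Icc a b) (F k))
    (hFm : ∀ k, Measurable (F k)) (hlim : ∀ t ∈ Icc a b, Tendsto (F · t) atTop (𝓝 (f t)))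
    {t : ℝ} (ht : t ∈ Icc a b) :
    Tendsto (fun k => leftDeriv γ a (fun s => F k s - F k a) t) atTop
      (𝓝 (leftDeriv γ a (fun s => f s - f a) t)) := by
  simp only [leftDeriv_sub_const]
  have ha : a ∈ Icc a b := ⟨le_rfl, ht.1.trans ht.2⟩
  refine (((hlim t ht).sub (hlim a ha)).div_const _ |>.add (Tendsto.const_mul _ ?_)).const_mul _
  have hk := intervalIntegrable_kernel (a := a) (t := t) (r := r - γ - 1) (by linarith)
  refine intervalIntegral.tendsto_integral_filter_of_dominated_convergence
    (fun s => C * (t - s) ^ (r - γ - 1)) ?_ ?_ (hk.const_mul C) ?_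
  · refine Eventually.of_forall fun k => ?_
    have := hFm k
    exact Measurable.aestronglyMeasurable (by fun_prop)
  · refine Eventually.of_forall fun k => ?_
    have hne : ∀ᵐ s : ℝ, s ≠ t := by simp [ae_iff]
    filter_upwards [hne] with s hs hs'
    rw [uIoc_of_le ht.1] at hs'
    exact norm_quotient_le (lt_of_le_of_ne hs'.2 hs) (hF k t ht s ⟨hs'.1.le, hs'.2.trans ht.2⟩)
  · refine Eventually.of_forall fun s hs => ?_
    rw [uIoc_of_le ht.1] at hs
    exact ((hlim t ht).sub (hlim s ⟨hs.1.le, hs.2.trans ht.2⟩)).div_const _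

end LeftDeriv

/-! ### The right fractional derivative, by reflection. -/

section RightDeriv

variable {γ a b C r : ℝ} {g : ℝ → ℝ}

lemma HolOn.comp_neg {E : Type*} [NormedAddCommGroup E] {g : ℝ → E}
    (hg : HolOn C r (Icc a b) g) : HolOn C r (Icc (-b) (-a)) fun s => g (-s) := by
  intro x hx y hy
  have := hg (-x) ⟨by linarith [hx.2], by linarith [hx.1]⟩ (-y) ⟨by linarith [hy.2],
    by linarith [hy.1]⟩
  rwa [← neg_add', abs_neg, ← sub_eq_add_neg] at this

lemma rightDeriv_eq_leftDeriv_sub (γ b : ℝ) (g : ℝ → ℝ) (t : ℝ) :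
    rightDeriv γ b (fun s => g s - g b) t =
      leftDeriv γ (-b) (fun s => (fun s => g (-s)) s - (fun s => g (-s)) (-b)) (-t) := by
  rw [rightDeriv_eq_leftDeriv]
  simp

lemma abs_rightDeriv_le (h0 : 0 < γ) (h1 : γ < 1) (hγr : γ < r) (hg : HolOn C r (Icc a b) g)
    {t : ℝ} (hat : a ≤ t) (htb : t < b) :
    |rightDeriv γ b (fun s => g s - g b) t| ≤ derivConst γ r * C * (b - t) ^ (r - γ) := by
  rw [rightDeriv_eq_leftDeriv_sub]
  have := abs_leftDeriv_le h0 h1 hγr hg.comp_neg (neg_lt_neg htb) (neg_le_neg hat)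
  rwa [show -t - -b = b - t by ring] at this

lemma aestronglyMeasurable_rightDeriv (γ a b : ℝ) (hgm : Measurable g) :
    AEStronglyMeasurable (fun t => rightDeriv γ b (fun s => g s - g b) t)
      (volume.restrict (Ioc a b)) := by
  simp only [rightDeriv_eq_leftDeriv_sub]
  have h := aestronglyMeasurable_leftDeriv (f := fun s => g (-s)) γ (-b) (-a)
    (hgm.comp measurable_neg)
  -- Reflection does not preserve half-open intervals of type `Ioc`, hence the passage to open ones.
  rw [← Measure.restrict_congr_set (Ioo_ae_eq_Ioc (μ := volume) (a := -b) (b := -a))] at h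
  have hp : MeasurePreserving (fun x : ℝ => -x) (volume.restrict (Ioo a b))
      (volume.restrict (Ioo (-b) (-a))) := by
    have := (Measure.measurePreserving_neg (volume : Measure ℝ)).restrict_preimage
      (measurableSet_Ioo (a := -b) (b := -a))
    simpa using this
  rw [← Measure.restrict_congr_set (Ioo_ae_eq_Ioc (μ := volume))]
  exact h.comp_measurePreserving hp

lemma tendsto_rightDeriv {G : ℕ → ℝ → ℝ} (hγr : γ < r) (hG : ∀ k, HolOn C r (Icc a b) (G k))
    (hGm : ∀ k, Measurable (G k)) (hlim : ∀ t ∈ Icc a b, Tendsto (G · t) atTop (𝓝 (g t)))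
    {t : ℝ} (ht : t ∈ Icc a b) :
    Tendsto (fun k => rightDeriv γ b (fun s => G k s - G k b) t) atTop
      (𝓝 (rightDeriv γ b (fun s => g s - g b) t)) := by
  simp only [rightDeriv_eq_leftDeriv_sub]
  refine tendsto_leftDeriv (b := -a) (F := fun k s => G k (-s)) (f := fun s => g (-s)) hγr
    (fun k => (hG k).comp_neg) (fun k => (hGm k).comp measurable_neg) (fun s hs => ?_)
    ⟨neg_le_neg ht.2, neg_le_neg ht.1⟩
  exact hlim (-s) ⟨by linarith [hs.2], by linarith [hs.1]⟩

end RightDeriv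

/-! ### Fractional derivatives of `C¹` functions. -/

section Smooth

variable {γ a b : ℝ} {f f' : ℝ → ℝ}

lemma exists_holOn_of_hasDerivAt (hf : ∀ x, HasDerivAt f (f' x) x) (hf' : Continuous f')
    (a b : ℝ) : ∃ C, HolOn C 1 (Icc a b) f := by
  obtain ⟨C, hC⟩ := isCompact_Icc.exists_bound_of_continuousOn (s := Icc a b) hf'.continuousOn
  refine ⟨C, fun x hx y hy => ?_⟩
  have := (convex_Icc a b).norm_image_sub_le_of_norm_hasDerivWithin_le (f := f) (f' := f')
    (fun x _ => (hf x).hasDerivWithinAt) hC hy hx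
  simpa using this

/-- Integration by parts with the primitive `(f t - f s) (t - s)^(-γ)`. It tends to `0` as `s → t`
since `f` is Lipschitz and `γ < 1`, and its value at `a` cancels the boundary term of the
derivative. -/
lemma leftDeriv_of_hasDerivAt (h1 : γ < 1) (hf : ∀ x, HasDerivAt f (f' x) x)
    (hf' : Continuous f') {t : ℝ} (hat : a < t) :
    leftDeriv γ a (fun s => f s - f a) t =
      1 / Real.Gamma (1 - γ) * ∫ s in a..t, f' s * (t - s) ^ (-γ) := by
  obtain ⟨C, hC⟩ := exists_holOn_of_hasDerivAt hf hf' a t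
  have hfc : Continuous f := continuous_iff_continuousAt.2 fun x => (hf x).continuousAt
  have ht : t ∈ Icc a t := ⟨hat.le, le_rfl⟩
  have hi1 : IntervalIntegrable (fun s => f' s * (t - s) ^ (-γ)) volume a t :=
    (intervalIntegrable_kernel (by linarith)).continuousOn_mul hf'.continuousOn
  have hi2 := intervalIntegrable_quotient (γ := γ) h1 hC hfc.measurable ht
  have key : ∫ s in a..t, (γ * ((f t - f s) / (t - s) ^ (γ + 1)) - f' s * (t - s) ^ (-γ)) =
      0 - (f t - f a) * (t - a) ^ (-γ) := by
    refine intervalIntegral.integral_eq_sub_of_hasDerivAt_of_tendsto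
      (f := fun s => (f t - f s) * (t - s) ^ (-γ)) hat (fun s hs => ?_)
      ((hi2.const_mul γ).sub hi1) ?_ ?_
    · have hts : 0 < t - s := sub_pos.2 hs.2
      have hd := ((hf s).const_sub (f t)).mul
        (((hasDerivAt_id s).const_sub t).rpow_const (p := -γ) (Or.inl hts.ne'))
      refine hd.congr_deriv ?_
      simp only [id]
      rw [show -γ - 1 = -(γ + 1) by ring, Real.rpow_neg hts.le (γ + 1)]
      ring
    · have : ContinuousAt (fun s => (f t - f s) * (t - s) ^ (-γ)) a :=
        (continuousAt_const.sub hfc.continuousAt).mul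
          ((continuousAt_const.sub continuousAt_id).rpow_const (Or.inl (sub_pos.2 hat).ne'))
      exact this.tendsto.mono_left nhdsWithin_le_nhds
    · have hlim : Tendsto (fun s => C * (t - s) ^ (1 - γ)) (𝓝[<] t) (𝓝 0) := by
        have : Continuous fun s : ℝ => C * (t - s) ^ (1 - γ) :=
          continuous_const.mul ((continuous_const.sub continuous_id).rpow_const
            fun _ => Or.inr (by linarith))
        have h2 := (this.tendsto t).mono_left (nhdsWithin_le_nhds (s := Iio t))
        simpa [Real.zero_rpow (sub_pos.2 h1).ne'] using h2
      refine squeeze_zero_norm' ?_ hlim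
      filter_upwards [Ioo_mem_nhdsLT hat] with s hs
      have hts : 0 < t - s := sub_pos.2 hs.2
      have h := hC t ht s ⟨hs.1.le, hs.2.le⟩
      rw [Real.rpow_one, abs_of_pos hts] at h
      rw [norm_mul, Real.norm_of_nonneg (Real.rpow_nonneg hts.le _), show 1 - γ = 1 + -γ by ring,
        Real.rpow_add hts, Real.rpow_one, ← mul_assoc]
      gcongr
  rw [intervalIntegral.integral_sub (hi2.const_mul γ) hi1, intervalIntegral.integral_const_mul]
    at key
  rw [leftDeriv_sub_const, div_eq_mul_inv (f t - f a), ← Real.rpow_neg (sub_pos.2 hat).le]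
  congr 1
  linarith

lemma rightDeriv_of_hasDerivAt (h1 : γ < 1) (hf : ∀ x, HasDerivAt f (f' x) x)
    (hf' : Continuous f') {t : ℝ} (htb : t < b) :
    rightDeriv γ b (fun s => f s - f b) t =
      -(1 / Real.Gamma (1 - γ) * ∫ s in t..b, f' s * (s - t) ^ (-γ)) := by
  have hd : ∀ x, HasDerivAt (fun s => f (-s)) (-f' (-x)) x := fun x => by
    have h := (hf (-x)).scomp x (hasDerivAt_neg x)
    simp only [neg_smul, one_smul] at h
    exact h
  rw [rightDeriv_eq_leftDeriv_sub,
    leftDeriv_of_hasDerivAt h1 hd (hf'.comp continuous_neg).neg (neg_lt_neg htb)]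
  have h := intervalIntegral.integral_comp_neg (a := -b) (b := -t)
    (fun s => f' s * (s - t) ^ (-γ))
  simp only [neg_neg] at h
  rw [← h, ← mul_neg, ← intervalIntegral.integral_neg]
  congr 2
  ext s
  rw [show -t - s = -s - t by ring]
  ring

end Smooth

/-! ### Fubini on a triangle with a singular kernel, and the Beta integral. -/

section Fubini

variable {a b p : ℝ}

lemma integral_triangle (hab : a ≤ b) {F : ℝ → ℝ → ℝ}
    (hF : Integrable (fun q : ℝ × ℝ => if a < q.1 ∧ q.1 < q.2 ∧ q.2 ≤ b then F q.1 q.2 else 0)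
      (volume.prod volume)) :
    ∫ x in a..b, ∫ y in x..b, F x y = ∫ y in a..b, ∫ x in a..y, F x y := by
  have hswap := integral_integral_swap
    (f := fun x y => if a < x ∧ x < y ∧ y ≤ b then F x y else 0) hF
  rw [intervalIntegral.integral_of_le hab, intervalIntegral.integral_of_le hab]
  convert hswap using 1
  · rw [← integral_indicator measurableSet_Ioc]
    congr 1
    ext x
    by_cases hx : x ∈ Ioc a b
    · rw [indicator_of_mem hx, intervalIntegral.integral_of_le hx.2,
        ← integral_indicator measurableSet_Ioc]
      simp only [indicator, mem_Ioc, hx.1, true_and]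
    · rw [indicator_of_notMem hx, eq_comm]
      refine integral_eq_zero_of_ae (Eventually.of_forall fun y => if_neg fun h => hx ?_)
      exact ⟨h.1, (h.2.1.le.trans h.2.2)⟩
  · rw [← integral_indicator measurableSet_Ioc]
    congr 1
    ext y
    by_cases hy : y ∈ Ioc a b
    · rw [indicator_of_mem hy, intervalIntegral.integral_of_le hy.1.le,
        integral_Ioc_eq_integral_Ioo, ← integral_indicator measurableSet_Ioo]
      simp only [indicator, mem_Ioo, hy.2, and_true]
    · rw [indicator_of_notMem hy, eq_comm]
      refine integral_eq_zero_of_ae (Eventually.of_forall fun x => if_neg fun h => hy ?_)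
      exact ⟨h.1.trans h.2.1, h.2.2⟩

lemma integrable_indicator_rpow (hp : -1 < p) (l : ℝ) :
    Integrable ((Ioo 0 l).indicator fun z : ℝ => z ^ p) := by
  rw [integrable_indicator_iff measurableSet_Ioo]
  exact (intervalIntegral.intervalIntegrable_rpow' (a := 0) (b := l) hp).1.mono_set
    Ioo_subset_Ioc_self

/-- On the triangle this is a convolution integrand times a bounded function. The kernel is cut off
at `b - a + 1`, where any length at least `b - a` would serve. -/
lemma integrable_triangle_left (hp : -1 < p) {φ ψ : ℝ → ℝ} (hφ : IntegrableOn φ (Ioc a b))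
    (hψ : Continuous ψ) :
    Integrable (fun q : ℝ × ℝ => if a < q.1 ∧ q.1 < q.2 ∧ q.2 ≤ b then
      φ q.1 * (q.2 - q.1) ^ p * ψ q.2 else 0) (volume.prod volume) := by
  have h := (((integrable_indicator_iff measurableSet_Ioc).2 hφ).convolution_integrand
    (ContinuousLinearMap.mul ℝ ℝ) (integrable_indicator_rpow hp (b - a + 1))).swap
  obtain ⟨C, hC⟩ := isCompact_Icc.exists_bound_of_continuousOn (s := Icc a b) hψ.continuousOn
  have h2 := h.mul_bdd (c := max C 0) (g := fun q : ℝ × ℝ => (Ioc a b).indicator ψ q.2)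
    ((hψ.measurable.indicator measurableSet_Ioc).comp measurable_snd).aestronglyMeasurable
    (Eventually.of_forall fun q => by
      by_cases hq : q.2 ∈ Ioc a b
      · simpa [hq] using Or.inl (hC q.2 ⟨hq.1.le, hq.2⟩)
      · simp [indicator_of_notMem hq])
  refine h2.congr (Eventually.of_forall fun q => ?_)
  simp only [Function.comp, Prod.fst_swap, Prod.snd_swap, ContinuousLinearMap.mul_apply',
    indicator, mem_Ioc, mem_Ioo]
  split_ifs <;> grind

lemma integrable_triangle_right (hp : -1 < p) {φ ψ : ℝ → ℝ} (hφ : Continuous φ)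
    (hψ : IntegrableOn ψ (Ioc a b)) :
    Integrable (fun q : ℝ × ℝ => if a < q.1 ∧ q.1 < q.2 ∧ q.2 ≤ b then
      φ q.1 * (q.2 - q.1) ^ p * ψ q.2 else 0) (volume.prod volume) := by
  have h := ((integrable_indicator_iff measurableSet_Ioc).2 hψ).convolution_integrand
    (ContinuousLinearMap.mul ℝ ℝ) (integrable_indicator_rpow hp (b - a + 1)).comp_neg
  obtain ⟨C, hC⟩ := isCompact_Icc.exists_bound_of_continuousOn (s := Icc a b) hφ.continuousOn
  have h2 := h.mul_bdd (c := max C 0) (g := fun q : ℝ × ℝ => (Ioc a b).indicator φ q.1)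
    ((hφ.measurable.indicator measurableSet_Ioc).comp measurable_fst).aestronglyMeasurable
    (Eventually.of_forall fun q => by
      by_cases hq : q.1 ∈ Ioc a b
      · simpa [hq] using Or.inl (hC q.1 ⟨hq.1.le, hq.2⟩)
      · simp [indicator_of_notMem hq])
  refine h2.congr (Eventually.of_forall fun q => ?_)
  simp only [ContinuousLinearMap.mul_apply', indicator, mem_Ioc, mem_Ioo, neg_sub]
  split_ifs <;> grind

/-- This is the Beta integral `B(1 - β, β)`; the parameters sum to `1`, so the length of the
interval scales out. -/
lemma integral_rpow_mul_rpow {β s r : ℝ} (h0 : 0 < β) (h1 : β < 1) (hsr : s < r) :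
    ∫ t in s..r, (t - s) ^ (-β) * (r - t) ^ (β - 1) = Real.Gamma (1 - β) * Real.Gamma β := by
  have hB := Complex.betaIntegral_scaled ((1 - β : ℝ) : ℂ) (β : ℂ) (sub_pos.2 hsr)
  have hΓ := Complex.Gamma_mul_Gamma_eq_betaIntegral (s := ((1 - β : ℝ) : ℂ)) (t := (β : ℂ))
    (by simpa using h1) (by simpa using h0)
  have h1' : ((1 - β : ℝ) : ℂ) + (β : ℂ) = 1 := by push_cast; ring
  rw [h1', Complex.Gamma_one, one_mul] at hΓ
  rw [h1', sub_self, Complex.cpow_zero, one_mul, ← hΓ, Complex.Gamma_ofReal,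
    Complex.Gamma_ofReal, ← Complex.ofReal_mul] at hB
  have hsub := intervalIntegral.integral_comp_sub_right (a := s) (b := r)
    (fun x => x ^ (-β) * ((r - s) - x) ^ (β - 1)) s
  simp only [sub_self, sub_sub_sub_cancel_right] at hsub
  rw [hsub]
  apply Complex.ofReal_injective
  rw [← hB, ← intervalIntegral.integral_ofReal]
  refine intervalIntegral.integral_congr fun x hx => ?_
  rw [uIcc_of_le (sub_pos.2 hsr).le] at hx
  simp only [Complex.ofReal_mul]
  rw [Complex.ofReal_cpow hx.1, Complex.ofReal_cpow (sub_nonneg.2 hx.2)]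
  push_cast
  congr 2
  ring

end Fubini

/-! ### The integral of `C¹` functions is the classical one. -/

section SmoothIntegral

variable {β a b : ℝ} {f f' g g' : ℝ → ℝ}

/-- Abel's inversion: the kernels of complementary orders convolve to a constant, so two fractional
integrations compose to an ordinary one. -/
lemma integral_convolution_kernel (h0 : 0 < β) (h1 : β < 1) (hf' : Continuous f') {r : ℝ}
    (har : a ≤ r) :
    ∫ t in a..r, (∫ s in a..t, f' s * (t - s) ^ (-β)) * (r - t) ^ (β - 1) =
      Real.Gamma (1 - β) * Real.Gamma β * ∫ s in a..r, f' s := by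
  have hψ : IntegrableOn (fun t => (r - t) ^ (β - 1)) (Ioc a r) :=
    (intervalIntegrable_kernel (by linarith)).1
  have htri := integral_triangle har (F := fun s t => f' s * (t - s) ^ (-β) * (r - t) ^ (β - 1))
    (integrable_triangle_right (by linarith) hf' hψ)
  simp only [intervalIntegral.integral_mul_const] at htri
  rw [← htri, ← intervalIntegral.integral_const_mul]
  refine intervalIntegral.integral_congr_ae ?_
  have hne : ∀ᵐ s : ℝ, s ≠ r := by simp [ae_iff]
  filter_upwards [hne] with s hs hs'
  rw [uIoc_of_le har] at hs'
  simp only [mul_assoc, intervalIntegral.integral_const_mul]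
  rw [integral_rpow_mul_rpow h0 h1 (lt_of_le_of_ne hs'.2 hs)]
  ring

lemma glsIntegral_of_continuousOn (γ : ℝ) (hab : a < b) (hf : ContinuousOn f (Icc a b))
    (hg : ContinuousOn g (Icc a b)) :
    glsIntegral γ f g a b =
      -(∫ t in a..b, leftDeriv γ a (fun s => f s - f a) t *
          rightDeriv (1 - γ) b (fun s => g s - g b) t) + f a * (g b - g a) := by
  have ha : a ∈ Icc a b := ⟨le_rfl, hab.le⟩
  have hb : b ∈ Icc a b := ⟨hab.le, le_rfl⟩
  have hright : ∀ h : ℝ → ℝ, ContinuousOn h (Icc a b) → Function.rightLim h a = h a :=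
    fun h hh => rightLim_eq_of_tendsto ((hh a ha).mono_left (by
      rw [nhdsWithin_Icc_eq_nhdsGE hab]
      exact nhdsWithin_mono _ Ioi_subset_Ici_self))
  have hleft : Function.leftLim g b = g b :=
    leftLim_eq_of_tendsto ((hg b hb).mono_left (by
      rw [nhdsWithin_Icc_eq_nhdsLE hab]
      exact nhdsWithin_mono _ Iio_subset_Iic_self))
  rw [glsIntegral, if_pos hab, hright f hf, hright g hg, hleft]

/-- Both derivatives become fractional integrals of `f'` and `g'`. Exchanging the order of
integration and applying Abel's inversion leaves `∫ (f - f a) g'`; the minus sign of the right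
derivative cancels the one in the definition, and the boundary term restores `f a`. -/
lemma glsIntegral_of_hasDerivAt (h0 : 0 < β) (h1 : β < 1) (hab : a ≤ b)
    (hf : ∀ x, HasDerivAt f (f' x) x) (hf' : Continuous f')
    (hg : ∀ x, HasDerivAt g (g' x) x) (hg' : Continuous g') :
    glsIntegral β f g a b = ∫ t in a..b, f t * g' t := by
  have hfc : Continuous f := continuous_iff_continuousAt.2 fun x => (hf x).continuousAt
  have hgc : Continuous g := continuous_iff_continuousAt.2 fun x => (hg x).continuousAt
  rcases hab.eq_or_lt with rfl | hab
  · simp [glsIntegral]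
  have hΓ := Real.Gamma_pos_of_pos h0
  have hΓ' := Real.Gamma_pos_of_pos (sub_pos.2 h1)
  set φ : ℝ → ℝ := fun t => ∫ s in a..t, f' s * (t - s) ^ (-β)
  have hLφ : ∀ t ∈ Ioc a b, leftDeriv β a (fun s => f s - f a) t =
      1 / Real.Gamma (1 - β) * φ t := fun t ht => leftDeriv_of_hasDerivAt h1 hf hf' ht.1
  have hφ : IntegrableOn φ (Ioc a b) := by
    obtain ⟨C, hC⟩ := exists_holOn_of_hasDerivAt hf hf' a b
    have hi : IntegrableOn (fun t => leftDeriv β a (fun s => f s - f a) t) (Ioc a b) := by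
      refine Integrable.of_bound (aestronglyMeasurable_leftDeriv β a b hfc.measurable)
        (derivConst β 1 * C * (b - a) ^ (1 - β)) ?_
      filter_upwards [ae_restrict_mem measurableSet_Ioc] with t ht
      refine (abs_leftDeriv_le h0 h1 h1 hC ht.1 ht.2).trans ?_
      have hC0 : 0 ≤ C := by
        have := hC a ⟨le_rfl, hab.le⟩ b ⟨hab.le, le_rfl⟩
        rw [Real.rpow_one] at this
        exact nonneg_of_mul_nonneg_left ((norm_nonneg _).trans this)
          (abs_pos.2 (sub_neg.2 hab).ne)
      have hc := derivConst_nonneg h0 h1 h1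
      have h2 : t - a ≤ b - a := by linarith [ht.2]
      have h3 : 0 ≤ t - a := by linarith [ht.1]
      gcongr
    refine IntegrableOn.congr_fun (hi.const_mul (Real.Gamma (1 - β))) (fun t ht => ?_)
      measurableSet_Ioc
    rw [hLφ t ht]
    field_simp
  have htri := integral_triangle hab.le (F := fun t r => φ t * (r - t) ^ (β - 1) * g' r)
    (integrable_triangle_left (by linarith) hφ hg')
  have hconv : ∫ r in a..b, ∫ t in a..r, φ t * (r - t) ^ (β - 1) * g' r =
      Real.Gamma (1 - β) * Real.Gamma β * ∫ r in a..b, (f r - f a) * g' r := by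
    rw [← intervalIntegral.integral_const_mul]
    refine intervalIntegral.integral_congr fun r hr => ?_
    rw [uIcc_of_le hab.le] at hr
    simp only [intervalIntegral.integral_mul_const]
    rw [integral_convolution_kernel h0 h1 hf' hr.1,
      intervalIntegral.integral_eq_sub_of_hasDerivAt (fun x _ => hf x)
        (hf'.intervalIntegrable a r)]
    ring
  have hprod : ∫ t in a..b, leftDeriv β a (fun s => f s - f a) t *
      rightDeriv (1 - β) b (fun s => g s - g b) t = -∫ r in a..b, (f r - f a) * g' r := by
    have : ∫ t in a..b, leftDeriv β a (fun s => f s - f a) t *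
        rightDeriv (1 - β) b (fun s => g s - g b) t =
        ∫ t in a..b, -(1 / (Real.Gamma (1 - β) * Real.Gamma β)) *
          ∫ r in t..b, φ t * (r - t) ^ (β - 1) * g' r := by
      refine intervalIntegral.integral_congr_ae ?_
      have hne : ∀ᵐ s : ℝ, s ≠ b := by simp [ae_iff]
      filter_upwards [hne] with t htb ht
      rw [uIoc_of_le hab.le] at ht
      rw [hLφ t ht, rightDeriv_of_hasDerivAt (by linarith) hg hg'
        (lt_of_le_of_ne ht.2 htb), show 1 - (1 - β) = β by ring,
        show -(1 - β) = β - 1 by ring]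
      simp only [mul_assoc, intervalIntegral.integral_const_mul, mul_comm (g' _)]
      field_simp
    rw [this, intervalIntegral.integral_const_mul, htri, hconv]
    field_simp
  rw [glsIntegral_of_continuousOn β hab hfc.continuousOn hgc.continuousOn, hprod, neg_neg,
    ← intervalIntegral.integral_eq_sub_of_hasDerivAt (fun x _ => hg x)
      (hg'.intervalIntegrable a b), ← intervalIntegral.integral_const_mul,
    ← intervalIntegral.integral_add]
  · refine intervalIntegral.integral_congr fun r _ => ?_
    ring
  · exact ((hfc.sub continuous_const).mul hg').intervalIntegrable a b
  · exact (continuous_const.mul hg').intervalIntegrable a b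

end SmoothIntegral

/-! ### Steklov averages. -/

section Steklov

variable {C r : ℝ} {f g : ℝ → ℝ}

/-- Steklov average of `f` over `[t, t + 1/(k+1)]`. -/
noncomputable def steklov (k : ℕ) (f : ℝ → ℝ) (t : ℝ) : ℝ :=
  ∫ θ in (0 : ℝ)..1, f (t + θ / (k + 1))

/-- The derivative of the Steklov average. -/
noncomputable def steklovDeriv (k : ℕ) (f : ℝ → ℝ) (t : ℝ) : ℝ :=
  (k + 1) * (f (t + 1 / (k + 1)) - f t)

lemma continuous_steklovDeriv (k : ℕ) (hf : Continuous f) : Continuous (steklovDeriv k f) := by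
  unfold steklovDeriv
  fun_prop

lemma hasDerivAt_steklov (k : ℕ) (hf : Continuous f) (t : ℝ) :
    HasDerivAt (steklov k f) (steklovDeriv k f t) t := by
  have hk : (k : ℝ) + 1 ≠ 0 := by positivity
  have heq : steklov k f = fun t => (k + 1) *
      ((∫ s in (0 : ℝ)..(t + 1 / (k + 1)), f s) - ∫ s in (0 : ℝ)..t, f s) := by
    ext t
    rw [steklov, intervalIntegral.integral_comp_add_div f hk, smul_eq_mul,
      intervalIntegral.integral_interval_sub_left (hf.intervalIntegrable _ _)
        (hf.intervalIntegrable _ _), zero_div, add_zero]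
  rw [heq, steklovDeriv]
  have h1 : ∀ x, HasDerivAt (fun t => ∫ s in (0 : ℝ)..t, f s) (f x) x := fun x =>
    intervalIntegral.integral_hasDerivAt_right (hf.intervalIntegrable _ _)
      (hf.stronglyMeasurableAtFilter _ _) hf.continuousAt
  exact (((h1 _).comp_add_const t _).sub (h1 t)).const_mul _

/-- An average of translates keeps the Hölder constant. This uniformity in `k` is what dominated
convergence needs later. -/
lemma holOn_steklov (k : ℕ) (hr : 0 < r) (hf : HolOn C r univ f) :
    HolOn C r univ (steklov k f) := by
  intro x _ y _
  have hc := hf.continuous hr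
  rw [steklov, steklov, ← intervalIntegral.integral_sub
    (Continuous.intervalIntegrable (by fun_prop) _ _)
    (Continuous.intervalIntegrable (by fun_prop) _ _)]
  have h := intervalIntegral.norm_integral_le_of_norm_le_const (a := 0) (b := 1)
    (C := C * |x - y| ^ r) (f := fun θ => f (x + θ / (k + 1)) - f (y + θ / (k + 1)))
    (fun θ _ => by
      have := hf (x + θ / (k + 1)) trivial (y + θ / (k + 1)) trivial
      rwa [add_sub_add_right_eq_sub] at this)
  simpa using h

lemma HolOn.const_nonneg {E : Type*} [NormedAddCommGroup E] {f : ℝ → E} {s : Set ℝ}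
    (hf : HolOn C r s f) {x y : ℝ} (hx : x ∈ s) (hy : y ∈ s) (hxy : x ≠ y) : 0 ≤ C :=
  nonneg_of_mul_nonneg_left ((norm_nonneg _).trans (hf x hx y hy))
    (Real.rpow_pos_of_pos (abs_pos.2 (sub_ne_zero.2 hxy)) _)

lemma tendsto_steklov (hr : 0 < r) (hf : HolOn C r univ f) (t : ℝ) :
    Tendsto (fun k => steklov k f t) atTop (𝓝 (f t)) := by
  have hc := hf.continuous hr
  have hC : 0 ≤ C := hf.const_nonneg (mem_univ 0) (mem_univ 1) zero_ne_one
  rw [tendsto_iff_norm_sub_tendsto_zero]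
  have h0 : Tendsto (fun k : ℕ => C * (1 / ((k : ℝ) + 1)) ^ r) atTop (𝓝 0) := by
    have := (tendsto_one_div_add_atTop_nhds_zero_nat (𝕜 := ℝ)).rpow_const (p := r)
      (Or.inr hr.le)
    simpa [Real.zero_rpow hr.ne'] using this.const_mul C
  refine squeeze_zero (fun _ => norm_nonneg _) (fun k => ?_) h0
  have hk : (0 : ℝ) < k + 1 := by positivity
  have heq : steklov k f t - f t = ∫ θ in (0 : ℝ)..1, (f (t + θ / (k + 1)) - f t) := by
    rw [intervalIntegral.integral_sub (Continuous.intervalIntegrable (by fun_prop) _ _)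
      intervalIntegrable_const, steklov]
    simp
  rw [heq]
  have h := intervalIntegral.norm_integral_le_of_norm_le_const (a := 0) (b := 1)
    (C := C * (1 / ((k : ℝ) + 1)) ^ r) (f := fun θ => f (t + θ / (k + 1)) - f t)
    (fun θ hθ => by
      rw [uIoc_of_le zero_le_one] at hθ
      refine (hf _ trivial _ trivial).trans ?_
      rw [add_sub_cancel_left, abs_of_pos (div_pos hθ.1 hk)]
      have := hθ.1
      have := hθ.2
      gcongr)
  simpa using h

lemma steklov_sub (k : ℕ) (hf : Continuous f) (hg : Continuous g) :
    steklov k (f - g) = steklov k f - steklov k g := by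
  ext t
  simp only [steklov, Pi.sub_apply]
  exact intervalIntegral.integral_sub (Continuous.intervalIntegrable (by fun_prop) _ _)
    (Continuous.intervalIntegrable (by fun_prop) _ _)

lemma steklovDeriv_sub (k : ℕ) : steklovDeriv k (f - g) = steklovDeriv k f - steklovDeriv k g := by
  ext t
  simp only [steklovDeriv, Pi.sub_apply]
  ring

end Steklov

/-! ### Additivity and linearity of the integral on the real line. -/

section Approximation

variable {β a b c p q C D : ℝ} {f g : ℝ → ℝ}

/-- Dominated convergence at two levels: inside each fractional derivative, and then for their
product, which the shared constants `C` and `D` bound by a constant. -/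
lemma tendsto_glsIntegral (h0 : 0 < β) (h1 : β < 1) (hp : β < p) (hq : 1 - β < q) (hab : a ≤ b)
    {F G : ℕ → ℝ → ℝ} (hF : ∀ k, HolOn C p univ (F k)) (hG : ∀ k, HolOn D q univ (G k))
    (hf : HolOn C p univ f) (hg : HolOn D q univ g)
    (hFf : ∀ t, Tendsto (F · t) atTop (𝓝 (f t))) (hGg : ∀ t, Tendsto (G · t) atTop (𝓝 (g t))) :
    Tendsto (fun k => glsIntegral β (F k) (G k) a b) atTop (𝓝 (glsIntegral β f g a b)) := by
  rcases hab.eq_or_lt with rfl | hab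
  · simp [glsIntegral]
  have hp0 : 0 < p := by linarith
  have hq0 : 0 < q := by linarith
  have hC : 0 ≤ C := hf.const_nonneg (mem_univ 0) (mem_univ 1) zero_ne_one
  have hFc := fun k => (hF k).continuous hp0
  have hGc := fun k => (hG k).continuous hq0
  rw [glsIntegral_of_continuousOn β hab (hf.continuous hp0).continuousOn
    (hg.continuous hq0).continuousOn]
  simp_rw [fun k => glsIntegral_of_continuousOn β hab (hFc k).continuousOn (hGc k).continuousOn]
  refine Tendsto.add (Tendsto.neg ?_) ((hFf a).mul ((hGg b).sub (hGg a)))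
  refine intervalIntegral.tendsto_integral_filter_of_dominated_convergence
    (fun _ => derivConst β p * C * (b - a) ^ (p - β) *
      (derivConst (1 - β) q * D * (b - a) ^ (q - (1 - β)))) ?_ ?_ intervalIntegrable_const ?_
  · refine Eventually.of_forall fun k => ?_
    rw [uIoc_of_le hab.le]
    exact (aestronglyMeasurable_leftDeriv β a b (hFc k).measurable).mul
      (aestronglyMeasurable_rightDeriv (1 - β) a b (hGc k).measurable)
  · refine Eventually.of_forall fun k => ?_
    have hne : ∀ᵐ s : ℝ, s ≠ b := by simp [ae_iff]
    filter_upwards [hne] with t htb ht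
    rw [uIoc_of_le hab.le] at ht
    have hl := abs_leftDeriv_le h0 h1 hp ((hF k).mono (subset_univ _)) ht.1 ht.2
    have hr := abs_rightDeriv_le (by linarith) (by linarith) hq
      ((hG k).mono (subset_univ (Icc a b))) ht.1.le (lt_of_le_of_ne ht.2 htb)
    have hD : 0 ≤ D := hg.const_nonneg (mem_univ 0) (mem_univ 1) zero_ne_one
    have hc1 := derivConst_nonneg h0 h1 hp
    have hc2 := derivConst_nonneg (γ := 1 - β) (by linarith) (by linarith) hq
    have h2 : 0 ≤ t - a := by linarith [ht.1]
    have h3 : 0 ≤ b - t := by linarith [ht.2]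
    rw [norm_mul]
    refine mul_le_mul (hl.trans ?_) (hr.trans ?_) (norm_nonneg _) (by positivity)
    · have : t - a ≤ b - a := by linarith [ht.2]
      gcongr
    · have : b - t ≤ b - a := by linarith [ht.1]
      gcongr
  · refine Eventually.of_forall fun t ht => ?_
    rw [uIoc_of_le hab.le] at ht
    have ht' : t ∈ Icc a b := ⟨ht.1.le, ht.2⟩
    exact (tendsto_leftDeriv hp (fun k => (hF k).mono (subset_univ _))
        (fun k => (hFc k).measurable) (fun t _ => hFf t) ht').mul
      (tendsto_rightDeriv hq (fun k => (hG k).mono (subset_univ _))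
        (fun k => (hGc k).measurable) (fun t _ => hGg t) ht')

lemma tendsto_integral_steklov (h0 : 0 < β) (h1 : β < 1) (hp : β < p) (hq : 1 - β < q)
    (hab : a ≤ b) (hf : HolOn C p univ f) (hg : HolOn D q univ g) :
    Tendsto (fun k => ∫ t in a..b, steklov k f t * steklovDeriv k g t) atTop
      (𝓝 (glsIntegral β f g a b)) := by
  have hp0 : 0 < p := by linarith
  have hq0 : 0 < q := by linarith
  have h := tendsto_glsIntegral h0 h1 hp hq hab (fun k => holOn_steklov k hp0 hf)
    (fun k => holOn_steklov k hq0 hg) hf hg (tendsto_steklov hp0 hf) (tendsto_steklov hq0 hg)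
  refine h.congr fun k => ?_
  exact glsIntegral_of_hasDerivAt h0 h1 hab (hasDerivAt_steklov k (hf.continuous hp0))
    (continuous_steklovDeriv k (hf.continuous hp0))
    (hasDerivAt_steklov k (hg.continuous hq0)) (continuous_steklovDeriv k (hg.continuous hq0))

lemma continuous_steklov_mul (k : ℕ) (hf : Continuous f) (hg : Continuous g) :
    Continuous fun t => steklov k f t * steklovDeriv k g t :=
  (continuous_iff_continuousAt.2 fun t => (hasDerivAt_steklov k hf t).continuousAt).mul
    (continuous_steklovDeriv k hg)

/-- The derivatives on `[a, b]`, `[b, c]` and `[a, c]` are unrelated pointwise, but all three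
integrals are limits of classical integrals of the same continuous functions. -/
lemma glsIntegral_add_adjacent_univ (h0 : 0 < β) (h1 : β < 1) (hp : β < p) (hq : 1 - β < q)
    (hab : a ≤ b) (hbc : b ≤ c) (hf : HolOn C p univ f) (hg : HolOn D q univ g) :
    glsIntegral β f g a b + glsIntegral β f g b c = glsIntegral β f g a c := by
  refine tendsto_nhds_unique ((tendsto_integral_steklov h0 h1 hp hq hab hf hg).add
    (tendsto_integral_steklov h0 h1 hp hq hbc hf hg)) ?_
  refine (tendsto_integral_steklov h0 h1 hp hq (hab.trans hbc) hf hg).congr fun k => ?_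
  have hc := continuous_steklov_mul k (hf.continuous (by linarith)) (hg.continuous (by linarith))
  exact (intervalIntegral.integral_add_adjacent_intervals (hc.intervalIntegrable _ _)
    (hc.intervalIntegrable _ _)).symm

lemma glsIntegral_sub_left_univ (h0 : 0 < β) (h1 : β < 1) (hp : β < p) (hq : 1 - β < q)
    (hab : a ≤ b) {f₂ : ℝ → ℝ} {C₂ : ℝ} (hf : HolOn C p univ f) (hf₂ : HolOn C₂ p univ f₂)
    (hg : HolOn D q univ g) :
    glsIntegral β (f - f₂) g a b = glsIntegral β f g a b - glsIntegral β f₂ g a b := by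
  refine tendsto_nhds_unique (tendsto_integral_steklov h0 h1 hp hq hab (hf.sub hf₂) hg) ?_
  refine ((tendsto_integral_steklov h0 h1 hp hq hab hf hg).sub
    (tendsto_integral_steklov h0 h1 hp hq hab hf₂ hg)).congr fun k => ?_
  have hfc := hf.continuous (by linarith)
  have hfc₂ := hf₂.continuous (by linarith)
  have hgc := hg.continuous (by linarith)
  rw [← intervalIntegral.integral_sub ((continuous_steklov_mul k hfc hgc).intervalIntegrable _ _)
    ((continuous_steklov_mul k hfc₂ hgc).intervalIntegrable _ _)]
  simp only [steklov_sub k hfc hfc₂, Pi.sub_apply, sub_mul]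

lemma glsIntegral_sub_right_univ (h0 : 0 < β) (h1 : β < 1) (hp : β < p) (hq : 1 - β < q)
    (hab : a ≤ b) {g₂ : ℝ → ℝ} {D₂ : ℝ} (hf : HolOn C p univ f) (hg : HolOn D q univ g)
    (hg₂ : HolOn D₂ q univ g₂) :
    glsIntegral β f (g - g₂) a b = glsIntegral β f g a b - glsIntegral β f g₂ a b := by
  refine tendsto_nhds_unique (tendsto_integral_steklov h0 h1 hp hq hab hf (hg.sub hg₂)) ?_
  refine ((tendsto_integral_steklov h0 h1 hp hq hab hf hg).sub
    (tendsto_integral_steklov h0 h1 hp hq hab hf hg₂)).congr fun k => ?_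
  have hfc := hf.continuous (by linarith)
  have hgc := hg.continuous (by linarith)
  have hgc₂ := hg₂.continuous (by linarith)
  rw [← intervalIntegral.integral_sub ((continuous_steklov_mul k hfc hgc).intervalIntegrable _ _)
    ((continuous_steklov_mul k hfc hgc₂).intervalIntegrable _ _)]
  simp only [steklovDeriv_sub, Pi.sub_apply, mul_sub]

end Approximation

/-! ### Transfer from the real line to an interval. -/

section Clamp

variable {β a b c l u p q C D : ℝ} {f g : ℝ → ℝ}

/-- Extension of `f` from `[l, u]` to the real line by constants. -/
def clamp {E : Type*} (l u : ℝ) (f : ℝ → E) (s : ℝ) : E := f (max l (min u s))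

lemma eqOn_clamp {E : Type*} (l u : ℝ) (f : ℝ → E) : EqOn f (clamp l u f) (Icc l u) := by
  intro s hs
  rw [clamp, min_eq_right hs.2, max_eq_right hs.1]

lemma HolOn.clamp {E : Type*} [NormedAddCommGroup E] {f : ℝ → E} (hp : 0 < p) (hlu : l < u)
    (hf : HolOn C p (Icc l u) f) : HolOn C p univ (clamp l u f) := by
  intro x _ y _
  have hC : 0 ≤ C := hf.const_nonneg (left_mem_Icc.2 hlu.le) (right_mem_Icc.2 hlu.le) hlu.ne
  have hmem : ∀ s, max l (min u s) ∈ Icc l u := fun s =>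
    ⟨le_max_left _ _, max_le hlu.le (min_le_left _ _)⟩
  refine (hf _ (hmem x) _ (hmem y)).trans ?_
  have h : |max l (min u x) - max l (min u y)| ≤ |x - y| := by
    refine (abs_max_sub_max_le_max _ _ _ _).trans ?_
    rw [sub_self, abs_zero, max_eq_right (abs_nonneg _)]
    refine (abs_min_sub_min_le_max _ _ _ _).trans ?_
    rw [sub_self, abs_zero, max_eq_right (abs_nonneg _)]
  gcongr

lemma leftDeriv_congr {γ : ℝ} {f₂ : ℝ → ℝ} (h : EqOn f f₂ (Icc a b)) {t : ℝ} (ht : t ∈ Icc a b) :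
    leftDeriv γ a (fun s => f s - f a) t = leftDeriv γ a (fun s => f₂ s - f₂ a) t := by
  rw [leftDeriv_sub_const, leftDeriv_sub_const, h ht, h ⟨le_rfl, ht.1.trans ht.2⟩]
  congr 3
  refine intervalIntegral.integral_congr fun s hs => ?_
  rw [uIcc_of_le ht.1] at hs
  simp only [h ⟨hs.1, hs.2.trans ht.2⟩]

lemma rightDeriv_congr {γ : ℝ} {g₂ : ℝ → ℝ} (h : EqOn g g₂ (Icc a b)) {t : ℝ}
    (ht : t ∈ Icc a b) :
    rightDeriv γ b (fun s => g s - g b) t = rightDeriv γ b (fun s => g₂ s - g₂ b) t := by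
  rw [rightDeriv_eq_leftDeriv_sub, rightDeriv_eq_leftDeriv_sub]
  exact leftDeriv_congr (b := -a) (f := fun s => g (-s)) (f₂ := fun s => g₂ (-s))
    (fun s hs => h ⟨by linarith [hs.2], by linarith [hs.1]⟩) ⟨neg_le_neg ht.2, neg_le_neg ht.1⟩

lemma glsIntegral_congr {f₂ g₂ : ℝ → ℝ} (hf : ContinuousOn f (Icc a b))
    (hg : ContinuousOn g (Icc a b)) (hff : EqOn f f₂ (Icc a b)) (hgg : EqOn g g₂ (Icc a b)) :
    glsIntegral β f g a b = glsIntegral β f₂ g₂ a b := by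
  by_cases hab : a < b
  swap; · simp [glsIntegral, hab]
  have h : ∫ t in a..b, leftDeriv β a (fun s => f s - f a) t *
      rightDeriv (1 - β) b (fun s => g s - g b) t =
      ∫ t in a..b, leftDeriv β a (fun s => f₂ s - f₂ a) t *
        rightDeriv (1 - β) b (fun s => g₂ s - g₂ b) t := by
    refine intervalIntegral.integral_congr fun t ht => ?_
    rw [uIcc_of_le hab.le] at ht
    rw [leftDeriv_congr hff ht, rightDeriv_congr hgg ht]
  rw [glsIntegral_of_continuousOn β hab hf hg,
    glsIntegral_of_continuousOn β hab (hf.congr hff.symm) (hg.congr hgg.symm), h,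
    hff (left_mem_Icc.2 hab.le), hgg (left_mem_Icc.2 hab.le), hgg (right_mem_Icc.2 hab.le)]

lemma glsIntegral_clamp (hp : 0 < p) (hq : 0 < q) (hf : HolOn C p (Icc l u) f)
    (hg : HolOn D q (Icc l u) g) (hla : l ≤ a) (hbu : b ≤ u) :
    glsIntegral β f g a b = glsIntegral β (clamp l u f) (clamp l u g) a b :=
  glsIntegral_congr ((hf.continuousOn hp).mono (Icc_subset_Icc hla hbu))
    ((hg.continuousOn hq).mono (Icc_subset_Icc hla hbu))
    ((eqOn_clamp l u f).mono (Icc_subset_Icc hla hbu))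
    ((eqOn_clamp l u g).mono (Icc_subset_Icc hla hbu))

lemma glsIntegral_add_adjacent (h0 : 0 < β) (h1 : β < 1) (hp : β < p) (hq : 1 - β < q)
    (hlu : l < u) (hf : HolOn C p (Icc l u) f) (hg : HolOn D q (Icc l u) g)
    (hla : l ≤ a) (hab : a ≤ b) (hbc : b ≤ c) (hcu : c ≤ u) :
    glsIntegral β f g a b + glsIntegral β f g b c = glsIntegral β f g a c := by
  have hp0 : 0 < p := by linarith
  have hq0 : 0 < q := by linarith
  rw [glsIntegral_clamp hp0 hq0 hf hg hla (hbc.trans hcu),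
    glsIntegral_clamp hp0 hq0 hf hg (hla.trans hab) hcu, glsIntegral_clamp hp0 hq0 hf hg hla hcu]
  exact glsIntegral_add_adjacent_univ h0 h1 hp hq hab hbc (hf.clamp hp0 hlu) (hg.clamp hq0 hlu)

lemma glsIntegral_sub_left (h0 : 0 < β) (h1 : β < 1) (hp : β < p) (hq : 1 - β < q)
    (hlu : l < u) {f₂ : ℝ → ℝ} {C₂ : ℝ} (hf : HolOn C p (Icc l u) f)
    (hf₂ : HolOn C₂ p (Icc l u) f₂) (hg : HolOn D q (Icc l u) g)
    (hla : l ≤ a) (hab : a ≤ b) (hbu : b ≤ u) :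
    glsIntegral β (f - f₂) g a b = glsIntegral β f g a b - glsIntegral β f₂ g a b := by
  have hp0 : 0 < p := by linarith
  have hq0 : 0 < q := by linarith
  rw [glsIntegral_clamp hp0 hq0 (hf.sub hf₂) hg hla hbu, glsIntegral_clamp hp0 hq0 hf hg hla hbu,
    glsIntegral_clamp hp0 hq0 hf₂ hg hla hbu]
  exact glsIntegral_sub_left_univ h0 h1 hp hq hab (hf.clamp hp0 hlu) (hf₂.clamp hp0 hlu)
    (hg.clamp hq0 hlu)

lemma glsIntegral_sub_right (h0 : 0 < β) (h1 : β < 1) (hp : β < p) (hq : 1 - β < q)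
    (hlu : l < u) {g₂ : ℝ → ℝ} {D₂ : ℝ} (hf : HolOn C p (Icc l u) f)
    (hg : HolOn D q (Icc l u) g) (hg₂ : HolOn D₂ q (Icc l u) g₂)
    (hla : l ≤ a) (hab : a ≤ b) (hbu : b ≤ u) :
    glsIntegral β f (g - g₂) a b = glsIntegral β f g a b - glsIntegral β f g₂ a b := by
  have hp0 : 0 < p := by linarith
  have hq0 : 0 < q := by linarith
  rw [glsIntegral_clamp hp0 hq0 hf (hg.sub hg₂) hla hbu, glsIntegral_clamp hp0 hq0 hf hg hla hbu,
    glsIntegral_clamp hp0 hq0 hf hg₂ hla hbu]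
  exact glsIntegral_sub_right_univ h0 h1 hp hq hab (hf.clamp hp0 hlu) (hg.clamp hq0 hlu)
    (hg₂.clamp hq0 hlu)

end Clamp

/-! ### The driver norm and the Young-type estimate. -/

section Driver

variable {E : Type*} [NormedAddCommGroup E] {β T L C r a b : ℝ}

/-- A finite real bound `L` on both parts of `‖g‖_{1,1-β}`, including the endpoints `0`, `T`. -/
structure DriverBound (β T L : ℝ) (g : ℝ → E) : Prop where
  holOn : HolOn L (1 - β) (Icc 0 T) g
  lintegral_le : ∀ s t, 0 < s → s < t → t ≤ T →
    ∫⁻ y in Ioo s t, ENNReal.ofReal (‖g y - g s‖ / |y - s| ^ (2 - β)) ≤ ENNReal.ofReal L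

lemma HolOn.closure {s : Set ℝ} {g : ℝ → E} (hr : 0 ≤ r) (hg : ContinuousOn g (closure s))
    (h : HolOn C r s g) : HolOn C r (closure s) g := by
  have hc : ∀ y : ℝ, ContinuousOn (fun x => C * |x - y| ^ r) (_root_.closure s) := fun y =>
    (continuous_const.mul ((continuous_id.sub continuous_const).abs.rpow_const
      fun _ => Or.inr hr)).continuousOn
  have h1 : ∀ y ∈ s, ∀ x ∈ _root_.closure s, ‖g x - g y‖ ≤ C * |x - y| ^ r := fun y hy =>
    le_on_closure (fun x hx => h x hx y hy) (hg.sub continuousOn_const).norm (hc y)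
  intro x hx y hy
  refine le_on_closure (f := fun y => ‖g x - g y‖) (g := fun y => C * |x - y| ^ r)
    (fun y hy => h1 y hy x hx) (continuousOn_const.sub hg).norm ?_ hy
  simpa only [abs_sub_comm x] using hc x

/-- The supremum only sees `0 < s < t < T`. Continuity extends the Hölder bound to the closed
interval, and monotone convergence along `v n ↑ t` extends the integral bound to `t = T`. -/
lemma driverBound_of_driverNorm_le {m : ℕ} {g : ℝ → EuclideanSpace ℝ (Fin m)} (hT : 0 < T)
    (hβ : β < 1) (hL : 0 ≤ L) (hg : ContinuousOn g (Icc 0 T))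
    (h : driverNorm β T g ≤ ENNReal.ofReal L) : DriverBound β T L g := by
  have key : ∀ s t, 0 < s → s < t → t < T →
      (ENNReal.ofReal (‖g t - g s‖ / (t - s) ^ (1 - β))
        + ∫⁻ y in Ioo s t, ENNReal.ofReal (‖g y - g s‖ / |y - s| ^ (2 - β))) ≤
        ENNReal.ofReal L := by
    intro s t hs hst htT
    refine le_trans ?_ h
    unfold driverNorm
    exact le_iSup_of_le s (le_iSup_of_le t (le_iSup_of_le hs (le_iSup_of_le hst
      (le_iSup_of_le htT le_rfl))))
  constructor
  · rw [← closure_Ioo hT.ne] at hg ⊢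
    refine HolOn.closure (by linarith) hg ?_
    have hlt : ∀ s ∈ Ioo 0 T, ∀ t ∈ Ioo 0 T, s < t → ‖g t - g s‖ ≤ L * |t - s| ^ (1 - β) := by
      intro s hs t ht hst
      have := le_self_add.trans (key s t hs.1 hst ht.2)
      rw [ENNReal.ofReal_le_ofReal_iff hL,
        div_le_iff₀ (Real.rpow_pos_of_pos (sub_pos.2 hst) _)] at this
      rwa [abs_of_pos (sub_pos.2 hst)]
    intro x hx y hy
    rcases lt_trichotomy x y with hxy | rfl | hxy
    · rw [norm_sub_rev, abs_sub_comm]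
      exact hlt x hx y hy hxy
    · simp [Real.zero_rpow (sub_pos.2 hβ).ne']
    · exact hlt y hy x hx hxy
  · intro s t hs hst htT
    obtain ⟨v, hv, hvt, hlim⟩ := exists_seq_strictMono_tendsto' hst
    have hU : Ioo s t = ⋃ n, Ioo s (v n) := by
      ext y
      simp only [mem_iUnion, mem_Ioo]
      constructor
      · rintro ⟨h1, h2⟩
        obtain ⟨n, hn⟩ := (hlim.eventually (lt_mem_nhds h2)).exists
        exact ⟨n, h1, hn⟩
      · rintro ⟨n, h1, h2⟩
        exact ⟨h1, h2.trans (hvt n).2⟩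
    rw [hU, setLIntegral_iUnion_of_directed]
    · exact iSup_le fun n => le_add_self.trans (key s (v n) hs (hvt n).1 ((hvt n).2.trans_le htT))
    · exact directed_of_isDirected_le fun i j hij => Ioo_subset_Ioo_right (hv.monotone hij)

lemma DriverBound.mono {L' : ℝ} {g : ℝ → E} (h : DriverBound β T L g) (hL : L ≤ L') :
    DriverBound β T L' g :=
  ⟨h.holOn.mono_const hL, fun s t hs hst ht =>
    (h.lintegral_le s t hs hst ht).trans (ENNReal.ofReal_le_ofReal hL)⟩

lemma DriverBound.apply {m : ℕ} {g : ℝ → EuclideanSpace ℝ (Fin m)} (h : DriverBound β T L g)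
    (j : Fin m) : DriverBound β T L (fun s => g s j) := by
  have hle : ∀ x y, ‖g x j - g y j‖ ≤ ‖g x - g y‖ := fun x y => by
    simpa using PiLp.norm_apply_le (g x - g y) j
  refine ⟨fun x hx y hy => (hle x y).trans (h.holOn x hx y hy), fun s t hs hst ht => ?_⟩
  refine le_trans (lintegral_mono fun y => ENNReal.ofReal_le_ofReal ?_)
    (h.lintegral_le s t hs hst ht)
  have := hle y s
  gcongr

/-- The two parts of the driver norm match the two terms of the derivative of order `1 - β`, so no
Hölder exponent above `1 - β` is needed. -/
lemma abs_rightDeriv_le_of_driverBound {g : ℝ → ℝ} (hβ : 0 < β) (hβ1 : β < 1) (hL : 0 ≤ L)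
    (hg : DriverBound β T L g) {t : ℝ} (ht : 0 < t) (htb : t < b) (hbT : b ≤ T) :
    |rightDeriv (1 - β) b (fun s => g s - g b) t| ≤ 2 / Real.Gamma β * L := by
  have hΓ := Real.Gamma_pos_of_pos hβ
  have hbt : 0 < b - t := sub_pos.2 htb
  have hA : |(g t - g b) / (b - t) ^ (1 - β)| ≤ L := by
    have := hg.holOn t ⟨ht.le, htb.le.trans hbT⟩ b ⟨(ht.trans htb).le, hbT⟩
    rw [abs_sub_comm t b, abs_of_pos hbt] at this
    rwa [abs_div, abs_of_pos (Real.rpow_pos_of_pos hbt _),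
      div_le_iff₀ (Real.rpow_pos_of_pos hbt _)]
  have hB : |∫ s in t..b, (g t - g s) / (s - t) ^ (1 - β + 1)| ≤ L := by
    rw [intervalIntegral.integral_of_le htb.le, integral_Ioc_eq_integral_Ioo,
      ← Real.norm_eq_abs, ← ENNReal.ofReal_le_ofReal_iff hL]
    refine le_trans ?_ (hg.lintegral_le t b ht htb hbT)
    refine (ENNReal.ofReal_le_ofReal (norm_integral_le_lintegral_norm _)).trans ?_
    refine ENNReal.ofReal_toReal_le.trans ?_
    refine setLIntegral_mono' measurableSet_Ioo fun s hs => ENNReal.ofReal_le_ofReal ?_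
    rw [norm_div, norm_sub_rev, show 1 - β + 1 = 2 - β by ring, abs_of_pos (sub_pos.2 hs.1),
      Real.norm_of_nonneg (Real.rpow_nonneg (sub_pos.2 hs.1).le _)]
  have hexp : rightDeriv (1 - β) b (fun s => g s - g b) t = 1 / Real.Gamma β *
      ((g t - g b) / (b - t) ^ (1 - β) +
        (1 - β) * ∫ s in t..b, (g t - g s) / (s - t) ^ (1 - β + 1)) := by
    simp [rightDeriv]
  rw [hexp, abs_mul, abs_of_pos (one_div_pos.2 hΓ)]
  calc _ ≤ 1 / Real.Gamma β * (L + 1 * L) := by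
        refine mul_le_mul_of_nonneg_left ((abs_add_le _ _).trans (add_le_add hA ?_))
          (one_div_pos.2 hΓ).le
        rw [abs_mul, abs_of_pos (by linarith : 0 < 1 - β)]
        gcongr
        linarith
    _ = _ := by ring

/-- The constant in the Young-type estimate of the integral. -/
noncomputable def youngConst (β : ℝ) : ℝ := derivConst β (1 - β) * (2 / Real.Gamma β)

lemma youngConst_nonneg (hβ : 0 < β) (hβ2 : β < 1 / 2) : 0 ≤ youngConst β := by
  have := Real.Gamma_pos_of_pos hβ
  have := derivConst_nonneg (γ := β) (r := 1 - β) hβ (by linarith) (by linarith)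
  unfold youngConst
  positivity

lemma abs_glsIntegral_le {f g : ℝ → ℝ} {H : ℝ} (hβ : 0 < β) (hβ2 : β < 1 / 2) (hL : 0 ≤ L)
    (hH : 0 ≤ H) (hf : HolOn H (1 - β) (Icc a b) f) (hg : DriverBound β T L g) (ha : 0 ≤ a)
    (hab : a ≤ b) (hbT : b ≤ T) :
    |glsIntegral β f g a b| ≤
      L * (b - a) ^ (1 - β) * (|f a| + youngConst β * H * (b - a) ^ (1 - β)) := by
  rcases hab.eq_or_lt with rfl | hab
  · simp [glsIntegral, Real.zero_rpow (by linarith : 1 - β ≠ 0)]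
  have hba : 0 < b - a := sub_pos.2 hab
  have hγ : 0 < 1 - β := by linarith
  have hgc : ContinuousOn g (Icc a b) :=
    (hg.holOn.continuousOn hγ).mono (Icc_subset_Icc ha hbT)
  have hc := derivConst_nonneg (γ := β) (r := 1 - β) hβ (by linarith) (by linarith)
  have hΓ := Real.Gamma_pos_of_pos hβ
  rw [glsIntegral_of_continuousOn β hab (hf.continuousOn hγ) hgc]
  have h1 : |f a * (g b - g a)| ≤ |f a| * (L * (b - a) ^ (1 - β)) := by
    rw [abs_mul]
    have := hg.holOn b ⟨ha.trans hab.le, hbT⟩ a ⟨ha, hab.le.trans hbT⟩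
    rw [abs_of_pos hba] at this
    exact mul_le_mul_of_nonneg_left this (abs_nonneg _)
  have h2 : |∫ t in a..b, leftDeriv β a (fun s => f s - f a) t *
      rightDeriv (1 - β) b (fun s => g s - g b) t| ≤
      (derivConst β (1 - β) * H * (b - a) ^ (1 - β - β) * (2 / Real.Gamma β * L)) * |b - a| := by
    rw [← Real.norm_eq_abs]
    refine intervalIntegral.norm_integral_le_of_norm_le_const_ae ?_
    have hne : ∀ᵐ s : ℝ, s ≠ b := by simp [ae_iff]
    filter_upwards [hne] with t htb ht
    rw [uIoc_of_le hab.le] at ht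
    rw [norm_mul]
    have hta : 0 ≤ t - a := by linarith [ht.1]
    have htb' : t - a ≤ b - a := by linarith [ht.2]
    refine mul_le_mul ((abs_leftDeriv_le hβ (by linarith) (by linarith) hf ht.1 ht.2).trans ?_)
      (abs_rightDeriv_le_of_driverBound hβ (by linarith) hL hg (ha.trans_lt ht.1)
        (lt_of_le_of_ne ht.2 htb) hbT) (norm_nonneg _) (by positivity)
    have : 0 ≤ 1 - β - β := by linarith
    gcongr
  -- The exponents add up to `(1 - 2β) + 1 = 2 (1 - β)`: one factor `(b - a)^(1-β)` is the Hölder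
  -- modulus sought, the other is the gain on short intervals.
  have h3 : (b - a) ^ (1 - β - β) * |b - a| = (b - a) ^ (1 - β) * (b - a) ^ (1 - β) := by
    rw [abs_of_pos hba, ← Real.rpow_add_one hba.ne', ← Real.rpow_add hba]
    ring_nf
  calc _ ≤ _ := abs_add_le _ _
    _ ≤ (derivConst β (1 - β) * H * (2 / Real.Gamma β * L)) *
          ((b - a) ^ (1 - β - β) * |b - a|) + |f a| * (L * (b - a) ^ (1 - β)) := by
        rw [abs_neg]
        refine add_le_add (h2.trans (le_of_eq ?_)) h1
        ring
    _ = _ := by rw [h3, youngConst]; ring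

end Driver

/-! ### Matrix-valued integrands and vector-valued drivers. -/

section Vector

variable {n m : ℕ} {β T L H a b c : ℝ} {A : ℝ → EuclideanSpace ℝ (Fin n × Fin m)}
  {g : ℝ → EuclideanSpace ℝ (Fin m)}

lemma HolOn.apply {ι : Type*} [Fintype ι] {C r : ℝ} {s : Set ℝ} {A : ℝ → EuclideanSpace ℝ ι}
    (h : HolOn C r s A) (i : ι) : HolOn C r s (fun t => A t i) := fun x hx y hy => by
  refine le_trans ?_ (h x hx y hy)
  simpa using PiLp.norm_apply_le (A x - A y) i

lemma norm_le_sum_abs {ι : Type*} [Fintype ι] (v : EuclideanSpace ℝ ι) : ‖v‖ ≤ ∑ i, |v i| := by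
  classical
  rw [EuclideanSpace.norm_eq]
  refine Real.sqrt_le_iff.2 ⟨Finset.sum_nonneg fun i _ => abs_nonneg _, ?_⟩
  simpa using Finset.sum_sq_le_sq_sum_of_nonneg (s := Finset.univ) (f := fun i => |v i|)
    fun i _ => abs_nonneg _

lemma norm_glsIntegralVec_le (hβ : 0 < β) (hβ2 : β < 1 / 2) (hL : 0 ≤ L) (hH : 0 ≤ H)
    (hA : HolOn H (1 - β) (Icc a b) A) (hg : DriverBound β T L g) (ha : 0 ≤ a)
    (hab : a ≤ b) (hbT : b ≤ T) :
    ‖glsIntegralVec β A g a b‖ ≤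
      n * m * L * (b - a) ^ (1 - β) * (‖A a‖ + youngConst β * H * (b - a) ^ (1 - β)) := by
  have hba : 0 ≤ b - a := sub_nonneg.2 hab
  calc ‖glsIntegralVec β A g a b‖ ≤ ∑ i, |glsIntegralVec β A g a b i| := norm_le_sum_abs _
    _ ≤ ∑ _i : Fin n, ∑ _j : Fin m,
        L * (b - a) ^ (1 - β) * (‖A a‖ + youngConst β * H * (b - a) ^ (1 - β)) := by
        refine Finset.sum_le_sum fun i _ => ?_
        simp only [glsIntegralVec]
        refine (Finset.abs_sum_le_sum_abs _ _).trans (Finset.sum_le_sum fun j _ => ?_)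
        refine (abs_glsIntegral_le hβ hβ2 hL hH (hA.apply (i, j)) (hg.apply j) ha hab hbT).trans ?_
        have : |A a (i, j)| ≤ ‖A a‖ := PiLp.norm_apply_le (A a) (i, j)
        gcongr
    _ = _ := by simp; ring

variable {p q C D : ℝ}

lemma glsIntegralVec_add_adjacent (h0 : 0 < β) (h1 : β < 1) (hp : β < p) (hq : 1 - β < q)
    (hT : 0 < T) (hA : HolOn C p (Icc 0 T) A) (hg : HolOn D q (Icc 0 T) g)
    (ha : 0 ≤ a) (hab : a ≤ b) (hbc : b ≤ c) (hc : c ≤ T) :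
    glsIntegralVec β A g a b + glsIntegralVec β A g b c = glsIntegralVec β A g a c := by
  ext i
  simp only [glsIntegralVec, PiLp.add_apply, ← Finset.sum_add_distrib]
  exact Finset.sum_congr rfl fun j _ => glsIntegral_add_adjacent h0 h1 hp hq hT (hA.apply (i, j))
    (hg.apply j) ha hab hbc hc

lemma glsIntegralVec_sub_left (h0 : 0 < β) (h1 : β < 1) (hp : β < p) (hq : 1 - β < q)
    (hT : 0 < T) {A₂ : ℝ → EuclideanSpace ℝ (Fin n × Fin m)} {C₂ : ℝ}
    (hA : HolOn C p (Icc 0 T) A) (hA₂ : HolOn C₂ p (Icc 0 T) A₂) (hg : HolOn D q (Icc 0 T) g)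
    (ha : 0 ≤ a) (hab : a ≤ b) (hb : b ≤ T) :
    glsIntegralVec β (A - A₂) g a b = glsIntegralVec β A g a b - glsIntegralVec β A₂ g a b := by
  ext i
  simp only [glsIntegralVec, PiLp.sub_apply, ← Finset.sum_sub_distrib]
  exact Finset.sum_congr rfl fun j _ => glsIntegral_sub_left h0 h1 hp hq hT (hA.apply (i, j))
    (hA₂.apply (i, j)) (hg.apply j) ha hab hb

lemma glsIntegralVec_sub_right (h0 : 0 < β) (h1 : β < 1) (hp : β < p) (hq : 1 - β < q)
    (hT : 0 < T) {g₂ : ℝ → EuclideanSpace ℝ (Fin m)} {D₂ : ℝ}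
    (hA : HolOn C p (Icc 0 T) A) (hg : HolOn D q (Icc 0 T) g) (hg₂ : HolOn D₂ q (Icc 0 T) g₂)
    (ha : 0 ≤ a) (hab : a ≤ b) (hb : b ≤ T) :
    glsIntegralVec β A (g - g₂) a b = glsIntegralVec β A g a b - glsIntegralVec β A g₂ a b := by
  ext i
  simp only [glsIntegralVec, PiLp.sub_apply, ← Finset.sum_sub_distrib]
  exact Finset.sum_congr rfl fun j _ => glsIntegral_sub_right h0 h1 hp hq hT (hA.apply (i, j))
    (hg.apply j) (hg₂.apply j) ha hab hb

end Vector

/-! ### A Gronwall lemma in Hölder norm. -/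

section Gronwall

variable {E : Type*} [NormedAddCommGroup E] {γ T C₁ C₂ h e a b H : ℝ} {v : ℝ → E}

lemma holOn_of_lt {C r : ℝ} {s : Set ℝ} (hr : r ≠ 0)
    (h : ∀ x ∈ s, ∀ y ∈ s, x < y → ‖v y - v x‖ ≤ C * (y - x) ^ r) : HolOn C r s v := by
  intro x hx y hy
  rcases lt_trichotomy x y with hxy | rfl | hxy
  · rw [norm_sub_rev, abs_sub_comm, abs_of_pos (sub_pos.2 hxy)]
    exact h x hx y hy hxy
  · simp [Real.zero_rpow hr]
  · rw [abs_of_pos (sub_pos.2 hxy)]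
    exact h y hy x hx hxy

/-- The increments of `v` satisfy the a priori inequality of a Young differential equation. -/
def StepBound (γ T C₁ C₂ e : ℝ) (v : ℝ → E) : Prop :=
  ∀ a b H, 0 ≤ a → a < b → b ≤ T → 0 ≤ H → HolOn H γ (Icc a b) v →
    ‖v b - v a‖ ≤ (C₁ * (e + ‖v a‖) + C₂ * (b - a) ^ γ * H) * (b - a) ^ γ

/-- Replacing `‖v s‖` by `‖v a‖ + H h^γ` makes the total coefficient of `H` at most `(C₁ + C₂) h^γ ≤
1/2`. -/
lemma StepBound.improve (hγ : 0 < γ) (hC₁ : 0 ≤ C₁) (hC₂ : 0 ≤ C₂)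
    (hh : (C₁ + C₂) * h ^ γ ≤ 1 / 2) (hv : StepBound γ T C₁ C₂ e v) (ha : 0 ≤ a) (hbT : b ≤ T)
    (hba : b - a ≤ h) (hH : 0 ≤ H) (hol : HolOn H γ (Icc a b) v) :
    HolOn (C₁ * (e + ‖v a‖) + H / 2) γ (Icc a b) v := by
  refine holOn_of_lt hγ.ne' fun s hs t ht hst => ?_
  have hts : 0 < t - s := sub_pos.2 hst
  have h1 := hv s t H (ha.trans hs.1) hst (ht.2.trans hbT) hH
    (hol.mono (Icc_subset_Icc hs.1 ht.2))
  have h2 : ‖v s‖ ≤ ‖v a‖ + H * h ^ γ := by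
    have h3 := hol s hs a ⟨le_rfl, hs.1.trans hs.2⟩
    have h4 : |s - a| ≤ h := by rw [abs_of_nonneg (sub_nonneg.2 hs.1)]; linarith [hs.2]
    have h5 : |s - a| ^ γ ≤ h ^ γ := Real.rpow_le_rpow (abs_nonneg _) h4 hγ.le
    have h6 : ‖v s‖ ≤ ‖v a‖ + ‖v s - v a‖ := norm_le_insert' _ _
    exact h6.trans (by gcongr; exact h3.trans (by gcongr))
  have h7 : (t - s) ^ γ ≤ h ^ γ :=
    Real.rpow_le_rpow hts.le (by linarith [hs.1, ht.2]) hγ.le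
  refine h1.trans (mul_le_mul_of_nonneg_right ?_ (Real.rpow_nonneg hts.le _))
  calc C₁ * (e + ‖v s‖) + C₂ * (t - s) ^ γ * H
      ≤ C₁ * (e + (‖v a‖ + H * h ^ γ)) + C₂ * h ^ γ * H := by gcongr
    _ = C₁ * (e + ‖v a‖) + (C₁ + C₂) * h ^ γ * H := by ring
    _ ≤ C₁ * (e + ‖v a‖) + 1 / 2 * H := by gcongr
    _ = _ := by ring

/-- Iterating `X ↦ c + X / 2` converges to `2c`, so the initial Hölder constant `H` has only to be
finite and leaves no trace in the limit. -/
lemma StepBound.holOn_short (hγ : 0 < γ) (hC₁ : 0 ≤ C₁) (hC₂ : 0 ≤ C₂) (he : 0 ≤ e)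
    (hh : (C₁ + C₂) * h ^ γ ≤ 1 / 2) (hv : StepBound γ T C₁ C₂ e v) (ha : 0 ≤ a) (hbT : b ≤ T)
    (hba : b - a ≤ h) (hH : 0 ≤ H) (hol : HolOn H γ (Icc a b) v) :
    HolOn (2 * C₁ * (e + ‖v a‖)) γ (Icc a b) v := by
  have hk : ∀ k : ℕ, HolOn (2 * C₁ * (e + ‖v a‖) + H * (1 / 2) ^ k) γ (Icc a b) v := by
    intro k
    induction k with
    | zero => exact hol.mono_const (by
        have : 0 ≤ 2 * C₁ * (e + ‖v a‖) := by positivity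
        simpa using this)
    | succ k ih =>
      refine (hv.improve hγ hC₁ hC₂ hh ha hbT hba (by positivity) ih).mono_const (le_of_eq ?_)
      ring
  intro x hx y hy
  have hlim : Tendsto (fun k : ℕ => (2 * C₁ * (e + ‖v a‖) + H * (1 / 2) ^ k) * |x - y| ^ γ) atTop
      (𝓝 ((2 * C₁ * (e + ‖v a‖) + H * 0) * |x - y| ^ γ)) :=
    (((tendsto_pow_atTop_nhds_zero_of_lt_one (by norm_num) (by norm_num)).const_mul H).const_add
      _).mul_const _
  rw [mul_zero, add_zero] at hlim
  exact ge_of_tendsto' hlim fun k => hk k x hx y hy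

/-- Each step of length at most `h` multiplies `e + ‖v‖` by at most `1 + 2 C₁ h^γ`; the last step
before `t` starts at `max 0 (t - h)`. -/
lemma StepBound.growth (hγ : 0 < γ) (hC₁ : 0 ≤ C₁) (hh0 : 0 < h) (he : 0 ≤ e)
    (hol : ∀ a b, 0 ≤ a → b ≤ T → b - a ≤ h → HolOn (2 * C₁ * (e + ‖v a‖)) γ (Icc a b) v)
    (k : ℕ) : ∀ t, 0 ≤ t → t ≤ T → t ≤ k * h →
      e + ‖v t‖ ≤ (1 + 2 * C₁ * h ^ γ) ^ k * (e + ‖v 0‖) := by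
  induction k with
  | zero =>
    intro t h0 _ ht
    have : t = 0 := le_antisymm (by simpa using ht) h0
    simp [this]
  | succ k ih =>
    intro t h0 htT ht
    have ha0 : 0 ≤ max 0 (t - h) := le_max_left _ _
    have hat : max 0 (t - h) ≤ t := max_le h0 (by linarith)
    have hta : t - max 0 (t - h) ≤ h := by linarith [le_max_right 0 (t - h)]
    have h1 := ih _ ha0 (hat.trans htT) (max_le (by positivity) (by push_cast at ht; linarith))
    set a := max 0 (t - h)
    have h2 := hol a t ha0 htT hta t ⟨hat, le_rfl⟩ a ⟨le_rfl, hat⟩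
    have h3 : |t - a| ^ γ ≤ h ^ γ := by
      rw [abs_of_nonneg (sub_nonneg.2 hat)]
      exact Real.rpow_le_rpow (sub_nonneg.2 hat) hta hγ.le
    have h6 : ‖v t‖ ≤ ‖v a‖ + ‖v t - v a‖ := norm_le_insert' _ _
    calc e + ‖v t‖ ≤ e + (‖v a‖ + 2 * C₁ * (e + ‖v a‖) * h ^ γ) := by
          gcongr
          exact h6.trans (by gcongr; exact h2.trans (by gcongr))
      _ = (1 + 2 * C₁ * h ^ γ) * (e + ‖v a‖) := by ring
      _ ≤ (1 + 2 * C₁ * h ^ γ) * ((1 + 2 * C₁ * h ^ γ) ^ k * (e + ‖v 0‖)) := by gcongr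
      _ = _ := by ring

/-- Gronwall lemma in Hölder spaces, by iteration over short intervals of equal length. -/
lemma exists_holder_gronwall (E : Type*) [NormedAddCommGroup E] (hγ : 0 < γ) (hC₁ : 0 ≤ C₁)
    (hC₂ : 0 ≤ C₂) : ∃ K, 0 < K ∧ ∀ (v : ℝ → E) (e H : ℝ), 0 ≤ e → 0 ≤ H →
      HolOn H γ (Icc 0 T) v → StepBound γ T C₁ C₂ e v →
      (∀ t ∈ Icc 0 T, ‖v t‖ ≤ K * (e + ‖v 0‖)) ∧ HolOn (K * (e + ‖v 0‖)) γ (Icc 0 T) v := by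
  -- Chosen so that `(C₁ + C₂ + 1) h^γ = 1/2`; the added `1` excludes division by zero.
  set h : ℝ := (1 / (2 * (C₁ + C₂ + 1))) ^ (1 / γ) with hdef
  have hh0 : 0 < h := by positivity
  have hhγ : h ^ γ = 1 / (2 * (C₁ + C₂ + 1)) := by
    rw [hdef, ← Real.rpow_mul (by positivity), one_div_mul_cancel hγ.ne', Real.rpow_one]
  have hh : (C₁ + C₂) * h ^ γ ≤ 1 / 2 := by
    rw [hhγ, mul_one_div, div_le_div_iff₀ (by positivity) (by norm_num)]
    linarith
  set P : ℝ := (1 + 2 * C₁ * h ^ γ) ^ ⌈T / h⌉₊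
  have hP : 0 < P := by positivity
  -- The summand `1` serves the sup bound, `2 C₁` the increments over distances up to `h`, and `2 /
  -- h^γ` those over longer distances, where the sup bound suffices.
  refine ⟨P * (1 + 2 * C₁ + 2 / h ^ γ), by positivity, fun v e H he hH hol hv => ?_⟩
  have hshort : ∀ a b, 0 ≤ a → b ≤ T → b - a ≤ h →
      HolOn (2 * C₁ * (e + ‖v a‖)) γ (Icc a b) v := fun a b ha hb hba =>
    hv.holOn_short hγ hC₁ hC₂ he hh ha hb hba hH (hol.mono (Icc_subset_Icc ha hb))
  have hgrow : ∀ t ∈ Icc 0 T, e + ‖v t‖ ≤ P * (e + ‖v 0‖) := fun t ht =>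
    StepBound.growth hγ hC₁ hh0 he hshort _ t ht.1 ht.2
      (ht.2.trans ((div_le_iff₀ hh0).1 (Nat.le_ceil _)))
  have hR : 0 ≤ e + ‖v 0‖ := by positivity
  constructor
  · intro t ht
    calc ‖v t‖ ≤ e + ‖v t‖ := by linarith
      _ ≤ P * 1 * (e + ‖v 0‖) := by simpa using hgrow t ht
      _ ≤ _ := by
        gcongr
        have : 0 ≤ 2 * C₁ + 2 / h ^ γ := by positivity
        linarith
  · refine holOn_of_lt hγ.ne' fun s hs t ht hst => ?_
    have hts : 0 < t - s := sub_pos.2 hst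
    have htsγ : 0 < (t - s) ^ γ := Real.rpow_pos_of_pos hts _
    by_cases hsh : t - s ≤ h
    · have h1 := hshort s t hs.1 ht.2 hsh t ⟨hst.le, le_rfl⟩ s ⟨le_rfl, hst.le⟩
      rw [abs_of_pos hts] at h1
      refine h1.trans (mul_le_mul_of_nonneg_right ?_ htsγ.le)
      calc 2 * C₁ * (e + ‖v s‖) ≤ 2 * C₁ * (P * (e + ‖v 0‖)) := by gcongr; exact hgrow s hs
        _ = P * (2 * C₁) * (e + ‖v 0‖) := by ring
        _ ≤ _ := by
          gcongr
          have : 0 ≤ 1 + 2 / h ^ γ := by positivity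
          linarith
    · have h1 : 1 ≤ (t - s) ^ γ / h ^ γ := by
        rw [one_le_div (by positivity)]
        exact Real.rpow_le_rpow hh0.le (not_le.1 hsh).le hγ.le
      calc ‖v t - v s‖ ≤ ‖v t‖ + ‖v s‖ := norm_sub_le _ _
        _ ≤ 2 * (P * (e + ‖v 0‖)) * 1 := by linarith [hgrow s hs, hgrow t ht]
        _ ≤ 2 * (P * (e + ‖v 0‖)) * ((t - s) ^ γ / h ^ γ) := by gcongr
        _ = P * (2 / h ^ γ) * (e + ‖v 0‖) * (t - s) ^ γ := by ring
        _ ≤ _ := by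
          gcongr
          linarith

end Gronwall

/-! ### From the Hölder norm to the solution norm. -/

section SolutionNorm

variable {n : ℕ} {β T C : ℝ} {v : ℝ → EuclideanSpace ℝ (Fin n)}

/-- The integrand is at most `C (t - s)^(-2β)`, integrable because `β < 1/2`. -/
lemma solutionNorm_le (hβ2 : β < 1 / 2) (hT : 0 < T) (hC : 0 ≤ C)
    (hv : ∀ t ∈ Icc 0 T, ‖v t‖ ≤ C) (hol : HolOn C (1 - β) (Icc 0 T) v) :
    solutionNorm β T v ≤
      ENNReal.ofReal (1 + T ^ (1 - 2 * β) / (1 - 2 * β)) * ENNReal.ofReal C := by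
  have h2β : 0 < 1 - 2 * β := by linarith
  refine iSup₂_le fun t ht => ?_
  have h2 : ∫⁻ s in Ioo 0 t, ENNReal.ofReal (‖v t - v s‖ / |t - s| ^ (β + 1)) ≤
      ENNReal.ofReal (C * (T ^ (1 - 2 * β) / (1 - 2 * β))) := by
    have hint := (intervalIntegrable_kernel (a := 0) (t := t) (r := -2 * β)
      (by linarith)).const_mul C
    calc _ ≤ ∫⁻ s in Ioo 0 t, ENNReal.ofReal (C * (t - s) ^ (-2 * β)) := by
          refine setLIntegral_mono' measurableSet_Ioo fun s hs => ENNReal.ofReal_le_ofReal ?_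
          have hts : 0 < t - s := sub_pos.2 hs.2
          have := hol t ht s ⟨hs.1.le, hs.2.le.trans ht.2⟩
          rw [abs_of_pos hts] at this ⊢
          rw [div_le_iff₀ (Real.rpow_pos_of_pos hts _), mul_assoc, ← Real.rpow_add hts]
          rwa [show -2 * β + (β + 1) = 1 - β by ring]
      _ = ENNReal.ofReal (∫ s in Ioo 0 t, C * (t - s) ^ (-2 * β)) := by
          rw [ofReal_integral_eq_lintegral_ofReal]
          · exact hint.1.mono_set Ioo_subset_Ioc_self
          · filter_upwards [ae_restrict_mem measurableSet_Ioo] with s hs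
            have hts : 0 < t - s := sub_pos.2 hs.2
            simp only [Pi.zero_apply]
            positivity
      _ ≤ _ := by
          rw [← integral_Ioc_eq_integral_Ioo, ← intervalIntegral.integral_of_le ht.1,
            intervalIntegral.integral_const_mul, integral_kernel (by linarith), sub_zero,
            show -2 * β + 1 = 1 - 2 * β by ring]
          refine ENNReal.ofReal_le_ofReal ?_
          have := ht.1
          have := ht.2
          gcongr
  refine (add_le_add (ENNReal.ofReal_le_ofReal (hv t ht)) h2).trans (le_of_eq ?_)
  rw [← ENNReal.ofReal_add hC (by positivity), ← ENNReal.ofReal_mul (by positivity)]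
  ring_nf

end SolutionNorm

/-! ### Finiteness of the driver norm. -/

section Holder

variable {d : ℕ} {γ T r β D : ℝ} {v : ℝ → EuclideanSpace ℝ (Fin d)}

lemma IsHolder.exists_holOn (hγ : 0 ≤ γ) (h : IsHolder γ T v) :
    ∃ C, 0 ≤ C ∧ HolOn C γ (Icc 0 T) v := by
  obtain ⟨C, hC⟩ := h
  refine ⟨C, C.2, fun x hx y hy => ?_⟩
  have := hC.dist_le hx hy
  rwa [dist_eq_norm, Real.dist_eq, Real.coe_toNNReal _ hγ] at this

/-- An exponent `r > 1 - β` leaves the singularity `(y - s)^(r-(2-β))`, whose exponent exceeds `-1`.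
-/
lemma exists_driverNorm_le (hT : 0 < T) (hr : 1 - β < r)
    (hD : 0 ≤ D) (hv : HolOn D r (Icc 0 T) v) :
    ∃ L, 0 ≤ L ∧ driverNorm β T v ≤ ENNReal.ofReal L := by
  have hδ : 0 < r - (1 - β) := by linarith
  refine ⟨D * T ^ (r - (1 - β)) + D * (T ^ (r - (1 - β)) / (r - (1 - β))), by positivity, ?_⟩
  rw [ENNReal.ofReal_add (by positivity) (by positivity)]
  refine iSup₂_le fun s t => iSup₂_le fun hs hst => iSup_le fun htT => ?_
  have hts : 0 < t - s := sub_pos.2 hst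
  have hsT : s ∈ Icc 0 T := ⟨hs.le, (hst.trans htT).le⟩
  have hmono : (t - s) ^ (r - (1 - β)) ≤ T ^ (r - (1 - β)) :=
    Real.rpow_le_rpow hts.le (by linarith) hδ.le
  refine add_le_add (ENNReal.ofReal_le_ofReal ?_) ?_
  · have := hv t ⟨(hs.trans hst).le, htT.le⟩ s hsT
    rw [abs_of_pos hts] at this
    rw [div_le_iff₀ (Real.rpow_pos_of_pos hts _)]
    refine this.trans ?_
    calc D * (t - s) ^ r = D * ((t - s) ^ (r - (1 - β)) * (t - s) ^ (1 - β)) := by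
          rw [← Real.rpow_add hts, sub_add_cancel]
      _ ≤ D * (T ^ (r - (1 - β)) * (t - s) ^ (1 - β)) := by gcongr
      _ = _ := by ring
  · have hint : IntervalIntegrable (fun y => D * (y - s) ^ (r - (2 - β))) volume s t := by
      have := (intervalIntegral.intervalIntegrable_rpow' (a := 0) (b := t - s)
        (r := r - (2 - β)) (by linarith)).comp_sub_right s
      simpa using this.const_mul D
    calc _ ≤ ∫⁻ y in Ioo s t, ENNReal.ofReal (D * (y - s) ^ (r - (2 - β))) := by
          refine setLIntegral_mono' measurableSet_Ioo fun y hy => ENNReal.ofReal_le_ofReal ?_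
          have hys : 0 < y - s := sub_pos.2 hy.1
          have := hv y ⟨(hs.trans hy.1).le, (hy.2.trans htT).le⟩ s hsT
          rw [abs_of_pos hys] at this ⊢
          rwa [div_le_iff₀ (Real.rpow_pos_of_pos hys _), mul_assoc, ← Real.rpow_add hys,
            sub_add_cancel]
      _ = ENNReal.ofReal (∫ y in Ioo s t, D * (y - s) ^ (r - (2 - β))) := by
          rw [ofReal_integral_eq_lintegral_ofReal]
          · exact hint.1.mono_set Ioo_subset_Ioc_self
          · filter_upwards [ae_restrict_mem measurableSet_Ioo] with y hy
            have hys : 0 < y - s := sub_pos.2 hy.1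
            simp only [Pi.zero_apply]
            positivity
      _ ≤ _ := by
          rw [← integral_Ioc_eq_integral_Ioo, ← intervalIntegral.integral_of_le hst.le,
            intervalIntegral.integral_const_mul,
            intervalIntegral.integral_comp_sub_right (fun y => y ^ (r - (2 - β))) s, sub_self,
            integral_rpow (Or.inl (by linarith)),
            show r - (2 - β) + 1 = r - (1 - β) by ring, Real.zero_rpow hδ.ne', sub_zero]
          gcongr

end Holder

/-! ### Integrability and measurability of the drift. -/

section Drift

variable {T β : ℝ}

/-- Hölder's inequality in `L^(1/β)`: the conjugate exponent turns the length of the interval into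
`(t - s)^(1-β)`, the modulus required of solutions. -/
lemma exists_integral_abs_le {ρ : ℝ≥0∞} {b : ℝ → ℝ} (hβ : 0 < β) (hβ1 : β < 1)
    (hρ : ENNReal.ofReal (1 / β) ≤ ρ) (hb : MemLp b ρ (volume.restrict (Icc 0 T))) :
    ∃ B, 0 ≤ B ∧ IntegrableOn b (Icc 0 T) ∧ ∀ s t, 0 ≤ s → s ≤ t → t ≤ T →
      ∫ r in s..t, |b r| ≤ B * (t - s) ^ (1 - β) := by
  have hp : 1 ≤ ENNReal.ofReal (1 / β) := by
    rw [← ENNReal.ofReal_one]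
    exact ENNReal.ofReal_le_ofReal ((one_le_div hβ).2 hβ1.le)
  have hb' : MemLp b (ENNReal.ofReal (1 / β)) (volume.restrict (Icc 0 T)) := hb.mono_exponent hρ
  refine ⟨(eLpNorm b (ENNReal.ofReal (1 / β)) (volume.restrict (Icc 0 T))).toReal,
    ENNReal.toReal_nonneg, hb'.integrable hp, fun s t hs hst ht => ?_⟩
  have hle : volume.restrict (Ioc s t) ≤ volume.restrict (Icc 0 T) :=
    Measure.restrict_mono (Ioc_subset_Icc_self.trans (Icc_subset_Icc hs ht)) le_rfl
  have hm : AEStronglyMeasurable b (volume.restrict (Ioc s t)) := hb'.1.mono_measure hle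
  have h1 := eLpNorm_le_eLpNorm_mul_rpow_measure_univ hp hm
  have h2 : eLpNorm b (ENNReal.ofReal (1 / β)) (volume.restrict (Ioc s t)) ≤
      eLpNorm b (ENNReal.ofReal (1 / β)) (volume.restrict (Icc 0 T)) :=
    eLpNorm_mono_measure b hle
  have h3 : ∫ r in s..t, |b r| = (eLpNorm b 1 (volume.restrict (Ioc s t))).toReal := by
    rw [intervalIntegral.integral_of_le hst, eLpNorm_one_eq_lintegral_enorm,
      ← integral_norm_eq_lintegral_enorm hm]
    rfl
  rw [h3]
  have hne : eLpNorm b (ENNReal.ofReal (1 / β)) (volume.restrict (Icc 0 T)) ≠ ∞ := hb'.2.ne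
  have h4 : (1 : ℝ) / (1 : ℝ≥0∞).toReal - 1 / (ENNReal.ofReal (1 / β)).toReal = 1 - β := by
    rw [ENNReal.toReal_ofReal (by positivity)]
    simp
  rw [h4, Measure.restrict_apply_univ, Real.volume_Ioc,
    ENNReal.ofReal_rpow_of_nonneg (sub_nonneg.2 hst) (by linarith)] at h1
  have h5 := ENNReal.toReal_mono (ENNReal.mul_ne_top hne ENNReal.ofReal_ne_top)
    (h1.trans (mul_le_mul_left h2 _))
  rwa [ENNReal.toReal_mul,
    ENNReal.toReal_ofReal (Real.rpow_nonneg (sub_nonneg.2 hst) _)] at h5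

lemma aestronglyMeasurable_comp_simpleFunc {E F : Type*} [TopologicalSpace F]
    [NormedAddCommGroup E] {f : ℝ → F → E} {μ : Measure ℝ}
    (hf : ∀ x, AEStronglyMeasurable (fun t => f t x) μ) (φ : SimpleFunc ℝ F) :
    AEStronglyMeasurable (fun t => f t (φ t)) μ := by
  classical
  have h : (fun t => f t (φ t)) =
      fun t => ∑ c ∈ φ.range, (φ ⁻¹' {c}).indicator (fun t => f t c) t := by
    ext t
    rw [Finset.sum_eq_single (φ t)]
    · rw [indicator_of_mem (by simp)]
    · intro c _ hc
      exact indicator_of_notMem (fun h => hc (by simpa using h.symm)) _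
    · intro h
      exact absurd (φ.mem_range_self t) h
  rw [h]
  exact Finset.aestronglyMeasurable_fun_sum _ fun c _ =>
    (hf c).indicator (φ.measurableSet_preimage _)

/-- For simple `u` the composition is a finite sum of pieces measurable in `t`; continuity in the
state passes to the limit. -/
lemma aestronglyMeasurable_caratheodory {E F : Type*} [NormedAddCommGroup F]
    [NormedAddCommGroup E] {f : ℝ → F → E} {s : Set ℝ} (hs : MeasurableSet s)
    (hf : ∀ x, AEStronglyMeasurable (fun t => f t x) (volume.restrict s))
    (hfc : ∀ t ∈ s, Continuous (f t)) {u : ℝ → F} (hu : StronglyMeasurable u) :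
    AEStronglyMeasurable (fun t => f t (u t)) (volume.restrict s) := by
  refine aestronglyMeasurable_of_tendsto_ae atTop
    (fun k => aestronglyMeasurable_comp_simpleFunc hf (hu.approx k)) ?_
  filter_upwards [ae_restrict_mem hs] with t ht
  exact ((hfc t ht).tendsto _).comp (hu.tendsto_approx t)

end Drift

/-! ### Consequences of the conditions on the coefficients. -/

section Coefficients

variable {n m : ℕ} {T β : ℝ} {ρ : ℝ≥0∞}
  {f : ℝ → EuclideanSpace ℝ (Fin n) → EuclideanSpace ℝ (Fin n)}
  {σ : ℝ → EuclideanSpace ℝ (Fin n) → EuclideanSpace ℝ (Fin n × Fin m)}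

lemma CoefficientConditions.exists_lipschitz (h : CoefficientConditions T ρ f σ) :
    ∃ M, 0 < M ∧ (∀ t ∈ Icc 0 T, ∀ x y, ‖σ t x - σ t y‖ ≤ M * ‖x - y‖) ∧
      (∀ t ∈ Icc 0 T, ∀ s ∈ Icc 0 T, ∀ x, ‖σ t x - σ s x‖ ≤ M * |t - s|) ∧
      ∀ t ∈ Icc 0 T, ∀ s ∈ Icc 0 T, ∀ x i,
        ‖spaceDeriv σ i t x - spaceDeriv σ i s x‖ ≤ M * |t - s| := by
  obtain ⟨M, hM, h1, h2⟩ := h.lipschitz_σ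
  refine ⟨M, hM, h1, fun t ht s hs x => ?_, fun t ht s hs x i =>
    (le_add_of_nonneg_left (norm_nonneg _)).trans (h2 t ht s hs x i)⟩
  -- The time-Lipschitz condition is quantified over `i` and is empty for `n = 0`; the matrices then
  -- have no entries.
  rcases Nat.eq_zero_or_pos n with rfl | hn
  · rw [Subsingleton.elim (σ t x) (σ s x), sub_self, norm_zero]
    positivity
  · exact (le_add_of_nonneg_right (norm_nonneg _)).trans (h2 t ht s hs x ⟨0, hn⟩)

lemma CoefficientConditions.continuous_f (h : CoefficientConditions T ρ f σ) {t : ℝ}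
    (ht : t ∈ Icc 0 T) : Continuous (f t) := by
  refine continuous_iff_continuousAt.2 fun x => ?_
  obtain ⟨L, hL, hLip⟩ := h.lipschitz_f (‖x‖ + 1) (by positivity)
  have hon : LipschitzOnWith L.toNNReal (f t) (Metric.ball x 1) := by
    refine LipschitzOnWith.of_dist_le_mul fun y hy z hz => ?_
    have hball : ∀ y ∈ Metric.ball x 1, ‖y‖ ≤ ‖x‖ + 1 := fun y hy => by
      have h1 := norm_le_insert' y x
      have h2 := mem_ball_iff_norm.1 hy
      linarith
    rw [dist_eq_norm, dist_eq_norm, Real.coe_toNNReal _ hL.le]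
    exact hLip t ht y z (hball y hy) (hball z hz)
  exact hon.continuousOn.continuousAt (Metric.ball_mem_nhds x one_pos)

lemma CoefficientConditions.integrableOn_drift (hT : 0 < T) (hρ : 1 ≤ ρ)
    (h : CoefficientConditions T ρ f σ) {u : ℝ → EuclideanSpace ℝ (Fin n)}
    (hu : ContinuousOn u (Icc 0 T)) : IntegrableOn (fun r => f r (u r)) (Icc 0 T) := by
  obtain ⟨-, L₀, hL₀, b, hb, hgrow⟩ := h.growth_f
  have hbi : IntegrableOn b (Icc 0 T) := hb.integrable hρ
  -- Continuity of `u` is known on `[0, T]` only; the extension by constants is globally measurable.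
  have hclamp : Continuous (clamp 0 T u) := by
    have : Continuous fun s : ℝ => max 0 (min T s) := by fun_prop
    exact hu.comp_continuous this fun s => ⟨le_max_left _ _, max_le hT.le (min_le_left _ _)⟩
  have hm := aestronglyMeasurable_caratheodory measurableSet_Icc h.measurable_f
    (fun t ht => h.continuous_f ht) hclamp.stronglyMeasurable
  have hm' : AEStronglyMeasurable (fun r => f r (u r)) (volume.restrict (Icc 0 T)) := by
    refine hm.congr ?_
    filter_upwards [ae_restrict_mem measurableSet_Icc] with t ht
    rw [← eqOn_clamp 0 T u ht]
  have hi : IntegrableOn (fun r => L₀ * ‖u r‖ + b r) (Icc 0 T) :=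
    ((hu.norm.integrableOn_Icc).const_mul L₀).add hbi
  refine Integrable.mono' hi hm' ?_
  filter_upwards [ae_restrict_mem measurableSet_Icc] with t ht using hgrow t ht (u t)

lemma norm_apply_le_of_single {E : Type*} [NormedAddCommGroup E] [NormedSpace ℝ E] {c : ℝ}
    (A : EuclideanSpace ℝ (Fin n) →L[ℝ] E)
    (h : ∀ i, ‖A (EuclideanSpace.single i 1)‖ ≤ c) (v : EuclideanSpace ℝ (Fin n)) :
    ‖A v‖ ≤ n * c * ‖v‖ := by
  have hv : v = ∑ i, v i • EuclideanSpace.single i (1 : ℝ) := by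
    have := (EuclideanSpace.basisFun (Fin n) ℝ).sum_repr v
    simpa using this.symm
  calc ‖A v‖ = ‖∑ i, v i • A (EuclideanSpace.single i (1 : ℝ))‖ := by
        conv_lhs => rw [hv, map_sum]
        simp
    _ ≤ ∑ _i : Fin n, ‖v‖ * c := by
        refine (norm_sum_le _ _).trans (Finset.sum_le_sum fun i _ => ?_)
        rw [norm_smul]
        exact mul_le_mul (PiLp.norm_apply_le v i) (h i) (norm_nonneg _) (norm_nonneg _)
    _ = _ := by simp; ring

/-- Differentiate `σ t (p θ) - σ s (q θ)` along the segments `p` from `x₁` to `y₁` and `q` from `x₂`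
to `y₂`. The derivative is `Dσ(p)` applied to the difference of the velocities, plus `Dσ(p) - Dσ(q)`
applied to `y₂ - x₂`; convexity keeps the segments in the ball of radius `N`. With `x = u` and `y =
v` both terms are linear in `v - u`. -/
lemma norm_four_point_le {M MN N : ℝ} (hM : 0 < M) (hMN : 0 ≤ MN)
    (hdiff : ∀ t ∈ Icc 0 T, Differentiable ℝ (σ t))
    (hlip : ∀ t ∈ Icc 0 T, ∀ x y, ‖σ t x - σ t y‖ ≤ M * ‖x - y‖)
    (htime : ∀ t ∈ Icc 0 T, ∀ s ∈ Icc 0 T, ∀ x i,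
        ‖spaceDeriv σ i t x - spaceDeriv σ i s x‖ ≤ M * |t - s|)
    (hloc : ∀ t ∈ Icc 0 T, ∀ x y, ‖x‖ ≤ N → ‖y‖ ≤ N →
      ∀ i, ‖spaceDeriv σ i t x - spaceDeriv σ i t y‖ ≤ MN * ‖x - y‖)
    {s t : ℝ} (hs : s ∈ Icc 0 T) (ht : t ∈ Icc 0 T) {x₁ y₁ x₂ y₂ : EuclideanSpace ℝ (Fin n)}
    (hx₁ : ‖x₁‖ ≤ N) (hy₁ : ‖y₁‖ ≤ N) (hx₂ : ‖x₂‖ ≤ N) (hy₂ : ‖y₂‖ ≤ N) :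
    ‖(σ t y₁ - σ t x₁) - (σ s y₂ - σ s x₂)‖ ≤ M * ‖(y₁ - x₁) - (y₂ - x₂)‖ +
      n * (M * |t - s| + MN * (‖x₁ - x₂‖ + ‖y₁ - y₂‖)) * ‖y₂ - x₂‖ := by
  set p : ℝ → EuclideanSpace ℝ (Fin n) := fun θ => x₁ + θ • (y₁ - x₁) with hp
  set q : ℝ → EuclideanSpace ℝ (Fin n) := fun θ => x₂ + θ • (y₂ - x₂) with hq
  have hpd : ∀ θ, HasDerivAt p (y₁ - x₁) θ := fun θ => by
    have h := ((hasDerivAt_id θ).smul_const (y₁ - x₁)).const_add x₁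
    rw [one_smul] at h
    exact h
  have hqd : ∀ θ, HasDerivAt q (y₂ - x₂) θ := fun θ => by
    have h := ((hasDerivAt_id θ).smul_const (y₂ - x₂)).const_add x₂
    rw [one_smul] at h
    exact h
  have hball : ∀ (x y : EuclideanSpace ℝ (Fin n)) (θ : ℝ), ‖x‖ ≤ N → ‖y‖ ≤ N → 0 ≤ θ → θ ≤ 1 →
      ‖x + θ • (y - x)‖ ≤ N := by
    intro x y θ hx hy h0 h1
    have := (convex_closedBall (0 : EuclideanSpace ℝ (Fin n)) N).add_smul_sub_mem
      (mem_closedBall_zero_iff.2 hx) (mem_closedBall_zero_iff.2 hy) ⟨h0, h1⟩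
    simpa using this
  have hd : ∀ θ, HasDerivAt (fun θ => σ t (p θ) - σ s (q θ))
      (fderiv ℝ (σ t) (p θ) (y₁ - x₁) - fderiv ℝ (σ s) (q θ) (y₂ - x₂)) θ := fun θ =>
    ((hdiff t ht _).hasFDerivAt.comp_hasDerivAt θ (hpd θ)).sub
      ((hdiff s hs _).hasFDerivAt.comp_hasDerivAt θ (hqd θ))
  have hbound : ∀ θ ∈ Ico (0 : ℝ) 1,
      ‖fderiv ℝ (σ t) (p θ) (y₁ - x₁) - fderiv ℝ (σ s) (q θ) (y₂ - x₂)‖ ≤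
      M * ‖(y₁ - x₁) - (y₂ - x₂)‖ +
      n * (M * |t - s| + MN * (‖x₁ - x₂‖ + ‖y₁ - y₂‖)) * ‖y₂ - x₂‖ := by
    intro θ hθ
    have hfd : ‖fderiv ℝ (σ t) (p θ)‖ ≤ M := by
      have hl : LipschitzWith M.toNNReal (σ t) := LipschitzWith.of_dist_le_mul fun x y => by
        rw [dist_eq_norm, dist_eq_norm, Real.coe_toNNReal _ hM.le]
        exact hlip t ht x y
      have := norm_fderiv_le_of_lipschitz ℝ (x₀ := p θ) hl
      rwa [Real.coe_toNNReal _ hM.le] at this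
    have hpq : ‖p θ - q θ‖ ≤ ‖x₁ - x₂‖ + ‖y₁ - y₂‖ := by
      have : p θ - q θ = (1 - θ) • (x₁ - x₂) + θ • (y₁ - y₂) := by
        simp only [hp, hq]
        module
      rw [this]
      refine (norm_add_le _ _).trans ?_
      rw [norm_smul, norm_smul, Real.norm_of_nonneg hθ.1,
        Real.norm_of_nonneg (sub_nonneg.2 hθ.2.le)]
      refine add_le_add ?_ ?_
      · exact mul_le_of_le_one_left (norm_nonneg _) (by linarith [hθ.1])
      · exact mul_le_of_le_one_left (norm_nonneg _) hθ.2.le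
    have hsplit : fderiv ℝ (σ t) (p θ) (y₁ - x₁) - fderiv ℝ (σ s) (q θ) (y₂ - x₂) =
        fderiv ℝ (σ t) (p θ) ((y₁ - x₁) - (y₂ - x₂)) +
          (fderiv ℝ (σ t) (p θ) - fderiv ℝ (σ s) (q θ)) (y₂ - x₂) := by
      rw [map_sub (fderiv ℝ (σ t) (p θ)) (y₁ - x₁), sub_apply]
      abel
    have hdir : ∀ i, ‖(fderiv ℝ (σ t) (p θ) - fderiv ℝ (σ s) (q θ))
        (EuclideanSpace.single i 1)‖ ≤ M * |t - s| + MN * (‖x₁ - x₂‖ + ‖y₁ - y₂‖) := by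
      intro i
      have e : (fderiv ℝ (σ t) (p θ) - fderiv ℝ (σ s) (q θ)) (EuclideanSpace.single i 1) =
          (spaceDeriv σ i t (p θ) - spaceDeriv σ i s (p θ)) +
            (spaceDeriv σ i s (p θ) - spaceDeriv σ i s (q θ)) := by
        simp only [spaceDeriv, sub_apply]
        abel
      rw [e]
      refine (norm_add_le _ _).trans (add_le_add (htime t ht s hs _ i) ?_)
      refine (hloc s hs _ _ (hball _ _ θ hx₁ hy₁ hθ.1 hθ.2.le)
        (hball _ _ θ hx₂ hy₂ hθ.1 hθ.2.le) i).trans ?_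
      gcongr
    rw [hsplit]
    refine (norm_add_le _ _).trans (add_le_add ?_ (norm_apply_le_of_single _ hdir _))
    exact ((fderiv ℝ (σ t) (p θ)).le_opNorm _).trans (by gcongr)
  have h := norm_image_sub_le_of_norm_deriv_le_segment_01'
    (fun θ _ => (hd θ).hasDerivWithinAt) hbound
  have e : (σ t y₁ - σ t x₁) - (σ s y₂ - σ s x₂) =
      (σ t (p 1) - σ s (q 1)) - (σ t (p 0) - σ s (q 0)) := by
    simp only [hp, hq, one_smul, zero_smul, add_zero, add_sub_cancel]
    abel
  rw [e]
  exact h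

end Coefficients

/-! ### Uniform bounds and stability of solutions. -/

section Solutions

variable {n m : ℕ} {T α β L : ℝ} {ρ : ℝ≥0∞}
  {f : ℝ → EuclideanSpace ℝ (Fin n) → EuclideanSpace ℝ (Fin n)}
  {σ : ℝ → EuclideanSpace ℝ (Fin n) → EuclideanSpace ℝ (Fin n × Fin m)}
  {x : EuclideanSpace ℝ (Fin n)} {g : ℝ → EuclideanSpace ℝ (Fin m)}
  {u v : ℝ → EuclideanSpace ℝ (Fin n)}

lemma sub_le_mul_rpow {a b : ℝ} (hβ : 0 ≤ β) (ha : 0 ≤ a) (hab : a < b) (hb : b ≤ T) :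
    b - a ≤ T ^ β * (b - a) ^ (1 - β) := by
  have hba : 0 < b - a := sub_pos.2 hab
  calc b - a = (b - a) ^ β * (b - a) ^ (1 - β) := by
        rw [← Real.rpow_add hba, add_sub_cancel, Real.rpow_one]
    _ ≤ _ := by
        gcongr
        linarith

lemma norm_le_of_holOn {E : Type*} [NormedAddCommGroup E] {u : ℝ → E} {γ H a b : ℝ} (hγ : 0 ≤ γ)
    (hH : 0 ≤ H) (hu : HolOn H γ (Icc a b) u) {r : ℝ} (hr : r ∈ Icc a b) :
    ‖u r‖ ≤ ‖u a‖ + H * (b - a) ^ γ := by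
  have h1 := hu r hr a ⟨le_rfl, hr.1.trans hr.2⟩
  rw [abs_of_nonneg (sub_nonneg.2 hr.1)] at h1
  have h2 : (r - a) ^ γ ≤ (b - a) ^ γ :=
    Real.rpow_le_rpow (sub_nonneg.2 hr.1) (by linarith [hr.2]) hγ
  have h3 : ‖u r‖ ≤ ‖u a‖ + ‖u r - u a‖ := norm_le_insert' _ _
  exact h3.trans (by gcongr; exact h1.trans (by gcongr))

lemma holOn_diffusion {M H a b : ℝ} (hβ : 0 ≤ β) (hβ1 : β < 1) (hM : 0 ≤ M)
    (hlip : ∀ t ∈ Icc 0 T, ∀ x y, ‖σ t x - σ t y‖ ≤ M * ‖x - y‖)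
    (htime : ∀ t ∈ Icc 0 T, ∀ s ∈ Icc 0 T, ∀ x, ‖σ t x - σ s x‖ ≤ M * |t - s|)
    (ha : 0 ≤ a) (hb : b ≤ T) (hu : HolOn H (1 - β) (Icc a b) u) :
    HolOn (M * (H + T ^ β)) (1 - β) (Icc a b) fun s => σ s (u s) := by
  refine holOn_of_lt (by linarith) fun s hs t ht hst => ?_
  have hsT : s ∈ Icc 0 T := Icc_subset_Icc ha hb hs
  have htT : t ∈ Icc 0 T := Icc_subset_Icc ha hb ht
  have h1 := hu t ht s hs
  have h2 := sub_le_mul_rpow hβ hsT.1 hst htT.2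
  rw [abs_of_pos (sub_pos.2 hst)] at h1
  calc ‖σ t (u t) - σ s (u s)‖ ≤ ‖σ t (u t) - σ t (u s)‖ + ‖σ t (u s) - σ s (u s)‖ :=
        norm_sub_le_norm_sub_add_norm_sub _ _ _
    _ ≤ M * ‖u t - u s‖ + M * |t - s| := add_le_add (hlip t htT _ _) (htime t htT s hsT _)
    _ ≤ M * (H * (t - s) ^ (1 - β)) + M * (T ^ β * (t - s) ^ (1 - β)) := by
        rw [abs_of_pos (sub_pos.2 hst)]
        gcongr
    _ = _ := by ring

lemma IsSolution.zero (hT : 0 < T) (hu : IsSolution β T f σ x g u) : u 0 = x := by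
  have h := hu.2 0 ⟨le_rfl, hT.le⟩
  have h0 : glsIntegralVec β (fun s => σ s (u s)) g 0 0 = 0 := by
    ext i
    simp [glsIntegralVec, glsIntegral]
  rw [h0, intervalIntegral.integral_same, add_zero] at h
  exact sub_eq_zero.1 h

/-- Additivity of the integral restarts the equation at `a`. -/
lemma IsSolution.sub_eq {p C D a b : ℝ} (hβ : 0 < β) (hβ1 : β < 1) (hp : β < p)
    (hα : 1 - β < α) (hT : 0 < T)
    (hu : IsSolution β T f σ x g u) (hi : IntegrableOn (fun r => f r (u r)) (Icc 0 T))
    (hA : HolOn C p (Icc 0 T) fun s => σ s (u s)) (hg : HolOn D α (Icc 0 T) g)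
    (ha : 0 ≤ a) (hab : a ≤ b) (hb : b ≤ T) :
    u b - u a = (∫ r in a..b, f r (u r)) + glsIntegralVec β (fun s => σ s (u s)) g a b := by
  have hii : ∀ t ∈ Icc 0 T, IntervalIntegrable (fun r => f r (u r)) volume 0 t := fun t ht =>
    (intervalIntegrable_iff_integrableOn_Icc_of_le ht.1).2 (hi.mono_set (Icc_subset_Icc le_rfl ht.2))
  have h1 := hu.2 b ⟨ha.trans hab, hb⟩
  have h2 := hu.2 a ⟨ha, hab.trans hb⟩
  rw [← intervalIntegral.integral_interval_sub_left (hii b ⟨ha.trans hab, hb⟩)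
    (hii a ⟨ha, hab.trans hb⟩)]
  have h3 := glsIntegralVec_add_adjacent hβ hβ1 hp hα hT hA hg le_rfl ha hab hb
  rw [← sub_sub_sub_cancel_right (u b) (u a) x, h1, h2, ← h3]
  abel

/-- A priori inequality for solutions, uniform over the drivers bounded by `L`. -/
lemma exists_stepBound_solution (hT : 0 < T) (hβ : 0 < β) (hβ2 : β < 1 / 2) (hα : 1 - β < α)
    (hρ : ENNReal.ofReal (1 / β) ≤ ρ) (hfσ : CoefficientConditions T ρ f σ) (hL : 0 ≤ L) :
    ∃ C₁ C₂, 0 ≤ C₁ ∧ 0 ≤ C₂ ∧ ∀ (x : EuclideanSpace ℝ (Fin n))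
      (g : ℝ → EuclideanSpace ℝ (Fin m)) (u : ℝ → EuclideanSpace ℝ (Fin n)) (D : ℝ),
      HolOn D α (Icc 0 T) g → DriverBound β T L g → IsSolution β T f σ x g u →
      StepBound (1 - β) T C₁ C₂ 1 u := by
  have hγ : 0 < 1 - β := by linarith
  obtain ⟨M, hM, hlip, htime, -⟩ := hfσ.exists_lipschitz
  obtain ⟨K₀, hK₀, ζ, hζ, hgrow⟩ := hfσ.growth_σ
  obtain ⟨hρ2, L₀, hL₀, b₀, hb₀, hfgrow⟩ := hfσ.growth_f
  obtain ⟨B, hB, hb₀i, hB'⟩ := exists_integral_abs_le hβ (by linarith) hρ hb₀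
  have hρ1 : 1 ≤ ρ := le_trans (by norm_num) hρ2.le
  have hY := youngConst_nonneg hβ hβ2
  set Y := youngConst β
  refine ⟨L₀ * T ^ β + B + n * m * L * (2 * K₀ + Y * M * T ^ β * T ^ (1 - β)),
    L₀ * T ^ β + n * m * L * Y * M, by positivity, by positivity, ?_⟩
  intro x g u D hgD hg hu a b H ha hab hb hH hol
  obtain ⟨Cu, hCu, huC⟩ := hu.1.exists_holOn hγ.le
  have hi := hfσ.integrableOn_drift hT hρ1 (huC.continuousOn hγ)
  have hA := holOn_diffusion hβ.le (by linarith) hM.le hlip htime le_rfl le_rfl huC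
  have hA' := holOn_diffusion hβ.le (by linarith) hM.le hlip htime ha hb hol
  have hba : 0 < b - a := sub_pos.2 hab
  have hsub : Icc a b ⊆ Icc 0 T := Icc_subset_Icc ha hb
  have haT : a ∈ Icc 0 T := hsub (left_mem_Icc.2 hab.le)
  have hbaT := sub_le_mul_rpow hβ.le ha hab hb
  have hTγ : (b - a) ^ (1 - β) ≤ T ^ (1 - β) :=
    Real.rpow_le_rpow hba.le (by linarith) hγ.le
  rw [hu.sub_eq hβ (by linarith) (by linarith) hα hT hi hA hgD ha hab.le hb]
  set d := (b - a) ^ (1 - β)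
  have hd : 0 ≤ d := by positivity
  have h1 : ‖∫ r in a..b, f r (u r)‖ ≤ L₀ * (‖u a‖ + H * d) * (b - a) + B * d := by
    have hbi : IntervalIntegrable (fun r => |b₀ r|) volume a b :=
      (intervalIntegrable_iff_integrableOn_Icc_of_le hab.le).2
        (IntegrableOn.mono_set hb₀i.abs hsub)
    have := intervalIntegral.norm_integral_le_of_norm_le (μ := volume) hab.le
      (f := fun r => f r (u r)) (g := fun r => L₀ * (‖u a‖ + H * d) + |b₀ r|)
      (Eventually.of_forall fun r hr => by
        have hr' : r ∈ Icc a b := Ioc_subset_Icc_self hr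
        refine (hfgrow r (hsub hr') (u r)).trans (add_le_add ?_ (le_abs_self _))
        exact mul_le_mul_of_nonneg_left (norm_le_of_holOn hγ.le hH hol hr') hL₀.le)
      (intervalIntegrable_const.add hbi)
    rw [intervalIntegral.integral_add intervalIntegrable_const hbi,
      intervalIntegral.integral_const, smul_eq_mul] at this
    linarith [hB' a b ha hab.le hb]
  have h2 := norm_glsIntegralVec_le hβ hβ2 hL (by positivity) hA' hg ha hab.le hb
  have h3 : ‖σ a (u a)‖ ≤ K₀ * (2 + ‖u a‖) := by
    refine (hgrow a haT (u a)).trans (mul_le_mul_of_nonneg_left ?_ hK₀.le)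
    rcases le_total ‖u a‖ 1 with h | h
    · linarith [Real.rpow_le_one (norm_nonneg _) h hζ.1, norm_nonneg (u a)]
    · have := Real.rpow_le_rpow_of_exponent_le h hζ.2
      rw [Real.rpow_one] at this
      linarith
  have hnm : (0 : ℝ) ≤ n * m * L := by positivity
  have hw := norm_nonneg (u a)
  calc _ ≤ L₀ * (‖u a‖ + H * d) * (b - a) + B * d +
        n * m * L * d * (‖σ a (u a)‖ + Y * (M * (H + T ^ β)) * d) :=
        (norm_add_le _ _).trans (add_le_add h1 h2)
    _ ≤ L₀ * (‖u a‖ + H * d) * (T ^ β * d) + B * d + n * m * L * d *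
        (K₀ * (2 + ‖u a‖) + (Y * M * H * d + Y * M * T ^ β * T ^ (1 - β))) := by
        gcongr
        calc Y * (M * (H + T ^ β)) * d = Y * M * H * d + Y * M * T ^ β * d := by ring
          _ ≤ _ := by gcongr
    _ ≤ _ := by
        have e : 0 ≤ (L₀ * T ^ β + B * ‖u a‖ + n * m * L *
          (K₀ * ‖u a‖ + Y * M * T ^ β * T ^ (1 - β) * ‖u a‖)) * d := by positivity
        linarith

/-- A priori inequality for the difference of two solutions with different drivers. -/
lemma exists_stepBound_sub {R H₁ : ℝ} (hT : 0 < T) (hβ : 0 < β) (hβ2 : β < 1 / 2)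
    (hα : 1 - β < α) (hfσ : CoefficientConditions T ρ f σ)
    (hL : 0 ≤ L) (hR : 0 < R) (hH₁ : 0 ≤ H₁) (hu : ∀ t ∈ Icc 0 T, ‖u t‖ ≤ R)
    (huH : HolOn H₁ (1 - β) (Icc 0 T) u) :
    ∃ C₁ C₂, 0 ≤ C₁ ∧ 0 ≤ C₂ ∧ ∀ (g ω : ℝ → EuclideanSpace ℝ (Fin m))
      (v : ℝ → EuclideanSpace ℝ (Fin n)) (D ε : ℝ), 0 ≤ ε →
      HolOn D α (Icc 0 T) g → HolOn D α (Icc 0 T) ω →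
      DriverBound β T L g → DriverBound β T ε (g - ω) →
      IsSolution β T f σ x ω u → IsSolution β T f σ x g v →
      (∀ t ∈ Icc 0 T, ‖v t‖ ≤ R) → HolOn H₁ (1 - β) (Icc 0 T) v →
      StepBound (1 - β) T C₁ C₂ ε (v - u) := by
  have hγ : 0 < 1 - β := by linarith
  obtain ⟨M, hM, hlip, htime, htimeD⟩ := hfσ.exists_lipschitz
  obtain ⟨MN, hMN, hloc⟩ := hfσ.lipschitz_deriv R hR
  obtain ⟨LN, hLN, hflip⟩ := hfσ.lipschitz_f R hR
  obtain ⟨K₀, hK₀, ζ, hζ, hgrow⟩ := hfσ.growth_σ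
  have hρ1 : 1 ≤ ρ := le_trans (by norm_num) hfσ.growth_f.1.le
  have hY := youngConst_nonneg hβ hβ2
  set Y := youngConst β
  -- `Q` is the coefficient of the sup norm of `v - u` in the four-point estimate, after division by
  -- `(t - s)^(1-β)`. `S` below bounds the bracket of the Young estimate for `∫ σ(u) d(g - ω)`.
  set Q : ℝ := n * (M * T ^ β + MN * (H₁ + H₁))
  set S : ℝ := K₀ * (1 + R ^ ζ) + Y * (M * (H₁ + T ^ β)) * T ^ (1 - β)
  have hQ : 0 ≤ Q := by positivity
  have hS : 0 ≤ S := by positivity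
  refine ⟨LN * T ^ β + n * m * L * (M + Y * Q * T ^ (1 - β)) + n * m * S,
    LN * T ^ β + n * m * L * (Y * M + Y * Q * T ^ (1 - β)), by positivity, by positivity, ?_⟩
  intro g ω v D ε hε hgD hωD hg hgω hsu hsv hv hvH a b H ha hab hb hH hol
  have hiu := hfσ.integrableOn_drift hT hρ1 (huH.continuousOn hγ)
  have hiv := hfσ.integrableOn_drift hT hρ1 (hvH.continuousOn hγ)
  have hAu := holOn_diffusion hβ.le (by linarith) hM.le hlip htime le_rfl le_rfl huH
  have hAv := holOn_diffusion hβ.le (by linarith) hM.le hlip htime le_rfl le_rfl hvH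
  have hba : 0 < b - a := sub_pos.2 hab
  have hsub : Icc a b ⊆ Icc 0 T := Icc_subset_Icc ha hb
  have haT : a ∈ Icc 0 T := hsub (left_mem_Icc.2 hab.le)
  have hbaT := sub_le_mul_rpow hβ.le ha hab hb
  have hTγ : (b - a) ^ (1 - β) ≤ T ^ (1 - β) :=
    Real.rpow_le_rpow hba.le (by linarith) hγ.le
  have hw := norm_nonneg ((v - u) a)
  have hmain : (v - u) b - (v - u) a = (∫ r in a..b, (f r (v r) - f r (u r))) +
      glsIntegralVec β ((fun s => σ s (v s)) - fun s => σ s (u s)) g a b +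
      glsIntegralVec β (fun s => σ s (u s)) (g - ω) a b := by
    have e1 := hsv.sub_eq hβ (by linarith) (by linarith) hα hT hiv hAv hgD ha hab.le hb
    have e2 := hsu.sub_eq hβ (by linarith) (by linarith) hα hT hiu hAu hωD ha hab.le hb
    rw [glsIntegralVec_sub_left hβ (by linarith) (by linarith) hα hT hAv hAu hgD ha hab.le hb,
      glsIntegralVec_sub_right hβ (by linarith) (by linarith) hα hT hAu hgD hωD ha hab.le hb,
      intervalIntegral.integral_sub
        ((intervalIntegrable_iff_integrableOn_Icc_of_le hab.le).2 (hiv.mono_set hsub))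
        ((intervalIntegrable_iff_integrableOn_Icc_of_le hab.le).2 (hiu.mono_set hsub))]
    simp only [Pi.sub_apply]
    rw [sub_sub_sub_comm, e1, e2]
    abel
  rw [hmain]
  set d := (b - a) ^ (1 - β)
  set w := ‖(v - u) a‖
  have hd : 0 ≤ d := by positivity
  have hwr : ∀ r ∈ Icc a b, ‖v r - u r‖ ≤ w + H * d := fun r hr =>
    norm_le_of_holOn hγ.le hH hol hr
  have h1 : ‖∫ r in a..b, (f r (v r) - f r (u r))‖ ≤ LN * (w + H * d) * (b - a) := by
    have := intervalIntegral.norm_integral_le_of_norm_le_const (a := a) (b := b)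
      (f := fun r => f r (v r) - f r (u r)) (C := LN * (w + H * d)) (fun r hr => by
        rw [uIoc_of_le hab.le] at hr
        have hr' : r ∈ Icc a b := Ioc_subset_Icc_self hr
        have hrT := hsub hr'
        exact (hflip r hrT _ _ (hv r hrT) (hu r hrT)).trans
          (mul_le_mul_of_nonneg_left (hwr r hr') hLN.le))
    rwa [abs_of_pos hba] at this
  -- Here the radius `R` and the Hölder constant `H₁`, common to both solutions, make the constant
  -- linear in `v - u`.
  have hB : HolOn (M * H + Q * (w + H * d)) (1 - β) (Icc a b)
      ((fun s => σ s (v s)) - fun s => σ s (u s)) := by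
    refine holOn_of_lt hγ.ne' fun s hs t ht hst => ?_
    have hsT := hsub hs
    have htT := hsub ht
    have hts : 0 < t - s := sub_pos.2 hst
    have h4 := norm_four_point_le hM hMN.le hfσ.differentiable_σ hlip htimeD hloc hsT htT
      (hu t htT) (hv t htT) (hu s hsT) (hv s hsT)
    have h5 := hol t ht s hs
    have h6 := huH t htT s hsT
    have h7 := hvH t htT s hsT
    have h8 := sub_le_mul_rpow hβ.le hsT.1 hst htT.2
    rw [abs_of_pos hts] at h4 h5 h6 h7
    refine h4.trans ?_
    calc _ ≤ M * (H * (t - s) ^ (1 - β)) + n * (M * (T ^ β * (t - s) ^ (1 - β)) +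
          MN * (H₁ * (t - s) ^ (1 - β) + H₁ * (t - s) ^ (1 - β))) * (w + H * d) := by
          gcongr
          · exact h5
          · exact hwr s hs
      _ = _ := by ring
  have h2 := norm_glsIntegralVec_le hβ hβ2 hL (by positivity) hB hg ha hab.le hb
  have h3 := norm_glsIntegralVec_le hβ hβ2 hε (by positivity) (hAu.mono hsub) hgω ha hab.le hb
  have h2' : ‖((fun s => σ s (v s)) - fun s => σ s (u s)) a‖ ≤ M * w := hlip a haT _ _
  have h3' : ‖σ a (u a)‖ + Y * (M * (H₁ + T ^ β)) * d ≤ S := by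
    have hζ0 := hζ.1
    refine add_le_add ((hgrow a haT (u a)).trans ?_) (by gcongr)
    have := hu a haT
    gcongr
  have hnm : (0 : ℝ) ≤ n * m * L := by positivity
  calc _ ≤ LN * (w + H * d) * (b - a) +
        n * m * L * d * (‖((fun s => σ s (v s)) - fun s => σ s (u s)) a‖ +
          Y * (M * H + Q * (w + H * d)) * d) +
        n * m * ε * d * (‖σ a (u a)‖ + Y * (M * (H₁ + T ^ β)) * d) :=
        (norm_add₃_le).trans (add_le_add (add_le_add h1 h2) h3)
    _ ≤ LN * (w + H * d) * (T ^ β * d) +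
        n * m * L * d * (M * w + (Y * M * H * d + Y * Q * (w + H * d) * T ^ (1 - β))) +
        n * m * ε * d * S := by
        gcongr
        calc Y * (M * H + Q * (w + H * d)) * d = Y * M * H * d + Y * Q * (w + H * d) * d := by
              ring
          _ ≤ _ := by gcongr
    _ ≤ _ := by
        have e : 0 ≤ ((LN * T ^ β + n * m * L * (M + Y * Q * T ^ (1 - β))) * ε +
          n * m * S * w) * d := by positivity
        linarith

/-- Solutions are bounded in Hölder norm uniformly over the drivers bounded by `L`. -/
lemma exists_solution_bound (hT : 0 < T) (hβ : 0 < β) (hβ2 : β < 1 / 2) (hα : 1 - β < α)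
    (hρ : ENNReal.ofReal (1 / β) ≤ ρ) (hfσ : CoefficientConditions T ρ f σ) (hL : 0 ≤ L)
    (x : EuclideanSpace ℝ (Fin n)) :
    ∃ R, 0 < R ∧ ∀ (g : ℝ → EuclideanSpace ℝ (Fin m)) (u : ℝ → EuclideanSpace ℝ (Fin n)) (D : ℝ),
      HolOn D α (Icc 0 T) g → DriverBound β T L g → IsSolution β T f σ x g u →
      (∀ t ∈ Icc 0 T, ‖u t‖ ≤ R) ∧ HolOn R (1 - β) (Icc 0 T) u := by
  have hγ : 0 < 1 - β := by linarith
  obtain ⟨C₁, C₂, hC₁, hC₂, hstep⟩ := exists_stepBound_solution hT hβ hβ2 hα hρ hfσ hL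
  obtain ⟨K, hK, hgron⟩ := exists_holder_gronwall (T := T) (EuclideanSpace ℝ (Fin n)) hγ hC₁ hC₂
  refine ⟨K * (1 + ‖x‖), by positivity, fun g u D hgD hg hu => ?_⟩
  obtain ⟨Cu, hCu, huC⟩ := hu.1.exists_holOn hγ.le
  -- The constant `Cu` depends on the driver, but does not appear in the conclusion of the Gronwall
  -- lemma.
  have h := hgron u 1 Cu zero_le_one hCu huC (hstep x g u D hgD hg hu)
  rwa [hu.zero hT] at h

lemma driverNorm_le_add {g ω : ℝ → EuclideanSpace ℝ (Fin m)} (hω : ContinuousOn ω (Icc 0 T)) :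
    driverNorm β T g ≤ driverNorm β T (g - ω) + driverNorm β T ω := by
  refine iSup₂_le fun s t => iSup₂_le fun hs hst => iSup_le fun htT => ?_
  have hle : ∀ k : ℝ → EuclideanSpace ℝ (Fin m),
      ENNReal.ofReal (‖k t - k s‖ / (t - s) ^ (1 - β))
      + ∫⁻ y in Ioo s t, ENNReal.ofReal (‖k y - k s‖ / |y - s| ^ (2 - β)) ≤
        driverNorm β T k := fun k =>
    le_iSup_of_le s (le_iSup_of_le t (le_iSup_of_le hs (le_iSup_of_le hst
      (le_iSup_of_le htT le_rfl))))
  refine le_trans ?_ (add_le_add (hle (g - ω)) (hle ω))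
  have hpt : ∀ (y : ℝ) (c : ℝ), 0 ≤ c → ENNReal.ofReal (‖g y - g s‖ / c) ≤
      ENNReal.ofReal (‖(g - ω) y - (g - ω) s‖ / c) + ENNReal.ofReal (‖ω y - ω s‖ / c) := by
    intro y c hc
    rw [← ENNReal.ofReal_add (by positivity) (by positivity), ← add_div]
    refine ENNReal.ofReal_le_ofReal (div_le_div_of_nonneg_right ?_ hc)
    refine le_trans (le_of_eq ?_) (norm_add_le _ _)
    simp only [Pi.sub_apply]
    congr 1
    abel
  rw [add_add_add_comm]
  refine add_le_add (hpt t _ (Real.rpow_nonneg (sub_pos.2 hst).le _)) ?_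
  -- Splitting the integral requires measurability of one summand only, here that of `ω`.
  rw [← lintegral_add_right']
  · exact lintegral_mono fun y => hpt y _ (Real.rpow_nonneg (abs_nonneg _) _)
  · have hm : AEMeasurable ω (volume.restrict (Ioo s t)) :=
      (hω.mono (Ioo_subset_Icc_self.trans (Icc_subset_Icc hs.le htT.le))).aemeasurable
        measurableSet_Ioo
    exact ((hm.sub_const _).norm.div (Measurable.aemeasurable (by fun_prop))).ennreal_ofReal

/-- Stability of solutions with respect to the driver. -/
theorem exists_solutionNorm_sub_le {ι : Type*} {ω : ℝ → EuclideanSpace ℝ (Fin m)} (hT : 0 < T)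
    (hβ : 0 < β) (hβ2 : β < 1 / 2) (hα : 1 - β < α) (hρ : ENNReal.ofReal (1 / β) ≤ ρ)
    (hfσ : CoefficientConditions T ρ f σ) (hω : IsHolder α T ω) (hu : IsSolution β T f σ x ω u)
    (G : ι → ℝ → EuclideanSpace ℝ (Fin m)) (hG : ∀ δ, IsHolder α T (G δ))
    (uδ : ι → ℝ → EuclideanSpace ℝ (Fin n)) (huδ : ∀ δ, IsSolution β T f σ x (G δ) (uδ δ))
    {R₀ : ℝ≥0} (hR₀ : ∀ δ, driverNorm β T (G δ) ≤ R₀) :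
    ∃ K : ℝ≥0, ∀ δ, solutionNorm β T (uδ δ - u) ≤ K * driverNorm β T (G δ - ω) := by
  have hγ : 0 < 1 - β := by linarith
  have hα0 : 0 < α := by linarith
  obtain ⟨Dω, hDω, hωD⟩ := hω.exists_holOn hα0.le
  obtain ⟨Lω, hLω, hωL⟩ := exists_driverNorm_le hT hα hDω hωD
  -- One `L` for `ω` and the whole family, so that `u` and every `uδ δ` share the bound `R`.
  set L : ℝ := max Lω R₀
  have hL : 0 ≤ L := hLω.trans (le_max_left _ _)
  have hωb : DriverBound β T L ω :=
    (driverBound_of_driverNorm_le hT (by linarith) hLω (hωD.continuousOn hα0) hωL).mono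
      (le_max_left _ _)
  obtain ⟨R, hR, hbound⟩ := exists_solution_bound hT hβ hβ2 hα hρ hfσ hL x
  obtain ⟨huR, huH⟩ := hbound ω u Dω hωD hωb hu
  obtain ⟨C₁, C₂, hC₁, hC₂, hstep⟩ := exists_stepBound_sub (x := x) hT hβ hβ2 hα hfσ hL hR
    hR.le huR huH
  obtain ⟨K, hK, hgron⟩ := exists_holder_gronwall (T := T) (EuclideanSpace ℝ (Fin n)) hγ hC₁ hC₂
  refine ⟨(1 + T ^ (1 - 2 * β) / (1 - 2 * β)).toNNReal * K.toNNReal, fun δ => ?_⟩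
  obtain ⟨Dg, hDg, hgD⟩ := (hG δ).exists_holOn hα0.le
  have hgωD := hgD.sub hωD
  obtain ⟨Lε, hLε, hεL⟩ := exists_driverNorm_le (β := β) hT hα (by positivity) hgωD
  have hne : driverNorm β T (G δ - ω) ≠ ∞ := ne_top_of_le_ne_top ENNReal.ofReal_ne_top hεL
  set ε := (driverNorm β T (G δ - ω)).toReal
  have hε : 0 ≤ ε := ENNReal.toReal_nonneg
  have hεeq : driverNorm β T (G δ - ω) = ENNReal.ofReal ε := (ENNReal.ofReal_toReal hne).symm
  have hgb : DriverBound β T L (G δ) :=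
    (driverBound_of_driverNorm_le hT (by linarith) R₀.2 (hgD.continuousOn hα0)
      (by simpa using hR₀ δ)).mono (le_max_right _ _)
  have hgωb : DriverBound β T ε (G δ - ω) :=
    driverBound_of_driverNorm_le hT (by linarith) hε (hgωD.continuousOn hα0) hεeq.le
  obtain ⟨hvR, hvH⟩ := hbound (G δ) (uδ δ) Dg hgD hgb (huδ δ)
  have hs := hstep (G δ) ω (uδ δ) (max Dg Dω) ε hε (hgD.mono_const (le_max_left _ _))
    (hωD.mono_const (le_max_right _ _)) hgb hgωb hu (huδ δ) hvR hvH
  obtain ⟨h1, h2⟩ := hgron _ ε (R + R) hε (by positivity) (hvH.sub huH) hs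
  have h0 : ‖(uδ δ - u) 0‖ = 0 := by simp [(huδ δ).zero hT, hu.zero hT]
  -- All solutions start at `x`, so only `ε` remains on the right.
  rw [h0, add_zero] at h1 h2
  refine (solutionNorm_le hβ2 hT (by positivity) h1 h2).trans (le_of_eq ?_)
  rw [hεeq, ENNReal.ofReal_mul hK.le, ENNReal.coe_mul, mul_assoc]
  rfl

end Solutions

end FracSDE

theorem mainTheorem2 {n m : ℕ} {T α β : ℝ} {ρ : ℝ≥0∞} (hT : 0 < T) (hα : 1 / 2 < α)
    (hβ : 0 < β) (hαβ : β ∈ Set.Ioo (1 - α) (1 / 2)) (hρ : ENNReal.ofReal (1 / β) ≤ ρ)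
    (f : ℝ → EuclideanSpace ℝ (Fin n) → EuclideanSpace ℝ (Fin n))
    (σ : ℝ → EuclideanSpace ℝ (Fin n) → EuclideanSpace ℝ (Fin n × Fin m))
    (hfσ : FracSDE.CoefficientConditions T ρ f σ)
    (x : EuclideanSpace ℝ (Fin n))
    (ω : ℝ → EuclideanSpace ℝ (Fin m)) (hω : FracSDE.IsHolder α T ω)
    (u : ℝ → EuclideanSpace ℝ (Fin n)) (hu : FracSDE.IsSolution β T f σ x ω u)
    {D : Type*} (G : D → ℝ → EuclideanSpace ℝ (Fin m))
    (hG : ∀ δ, FracSDE.IsHolder α T (G δ))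
    (uδ : D → ℝ → EuclideanSpace ℝ (Fin n))
    (huδ : ∀ δ, FracSDE.IsSolution β T f σ x (G δ) (uδ δ)) :
    ((∃ R : ℝ≥0, ∀ δ, FracSDE.driverNorm β T (G δ) ≤ R) →
      ∃ K : ℝ≥0, ∀ δ, FracSDE.solutionNorm β T (uδ δ - u)
        ≤ K * FracSDE.driverNorm β T (G δ - ω)) ∧
    (∀ l : Filter D,
      Tendsto (fun δ => FracSDE.driverNorm β T (G δ - ω)) l (𝓝 0) →
        Tendsto (fun δ => FracSDE.solutionNorm β T (uδ δ - u)) l (𝓝 0)) := by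
  have hαβ' : 1 - β < α := by linarith [hαβ.1]
  refine ⟨fun ⟨R, hR⟩ => FracSDE.exists_solutionNorm_sub_le hT hβ hαβ.2 hαβ' hρ hfσ hω hu G hG
    uδ huδ hR, fun l hl => ?_⟩
  obtain ⟨Dω, hDω, hωD⟩ := hω.exists_holOn (by linarith)
  obtain ⟨Lω, hLω, hωL⟩ := FracSDE.exists_driverNorm_le (β := β) hT hαβ' hDω hωD
  -- Boundedness of the whole family is not assumed here. On this set, which is eventual along `l`,
  -- the triangle inequality provides it, and the estimate is applied to the subfamily.
  set s : Set D := {δ | FracSDE.driverNorm β T (G δ - ω) ≤ 1}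
  have hs : ∀ᶠ δ in l, δ ∈ s := (hl.eventually (gt_mem_nhds zero_lt_one)).mono fun δ hδ => hδ.le
  have hbound : ∀ δ : s, FracSDE.driverNorm β T (G δ) ≤ ((1 + Lω.toNNReal : ℝ≥0) : ℝ≥0∞) := by
    intro δ
    refine (FracSDE.driverNorm_le_add (hωD.continuousOn (by linarith))).trans
      (by push_cast; exact add_le_add δ.2 hωL)
  obtain ⟨K, hK⟩ := FracSDE.exists_solutionNorm_sub_le hT hβ hαβ.2 hαβ' hρ hfσ hω hu
    (fun δ : s => G δ) (fun δ => hG δ) (fun δ => uδ δ) (fun δ => huδ δ) hbound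
  have hlim : Tendsto (fun δ => (K : ℝ≥0∞) * FracSDE.driverNorm β T (G δ - ω)) l (𝓝 0) := by
    simpa using ENNReal.Tendsto.const_mul hl (Or.inr ENNReal.coe_ne_top)
  exact tendsto_of_tendsto_of_tendsto_of_le_of_le' tendsto_const_nhds hlim
    (Eventually.of_forall fun _ => zero_le) (hs.mono fun δ hδ => hK ⟨δ, hδ⟩)
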